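/- **Setting.** Let $1\le N_B\le T_{tr}\le T$ be integers, $P_b>0$, $\sigma_u^2>0$, $0<\epsilon<1$, $\rho_b=P_b/\sigma_u^2$ and $\Lambda=T_{tr}P_b/N_B$. The downlink channel $\mathbf h_d\in\mathbb C^{1\times N_B}$ has i.i.d. $\mathcal{CN}(0,1)$ entries. The user observes $\mathbf y_d=\sqrt{\Lambda}\,\mathbf h_d\mathbf S_d+\mathbf n_d$, where $\mathbf S_d\in\mathbb C^{N_B\times T_{tr}}$ satisfies $\mathbf S_d\mathbf S_d^H=\mathbf I$ and $\mathbf n_d$ has i.i.d. $\mathcal{CN}(0,\sigma_u^2)$ entries and is independent of $\mathbf h_d$. The user forms the linear MMSE estimate $\hat{\mathbf h}_d=\frac{\sqrt\Lambda}{\Lambda+\sigma_u^2}\mathbf y_d\mathbf S_d^H$, with error $\hat{\mathbf e}_d=\mathbf h_d-\hat{\mathbf h}_d$. The base station, knowing $\hat{\mathbf h}_d$, beamforms with $\mathbf v=\hat{\mathbf h}_d^H/\|\hat{\mathbf h}_d\|$, so the user receives $\sqrt{P_b}\,\mathbf h_d\mathbf v u+n=\sqrt{P_b}\|\hat{\mathbf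 h}_d\|u+\hat n$ with $\hat n=\sqrt{P_b}\,\hat{\mathbf e}_d\mathbf v u+n$. Here $\mathbb E|u|^2=1$, $n\sim\mathcal{CN}(0,\sigma_u^2)$, and $u$, $n$ and $(\mathbf h_d,\mathbf n_d)$ are independent. Put $\gamma_d=P_b\|\hat{\mathbf h}_d\|^2/\mathrm{Var}(\hat n)$, $C(\gamma)=\log_2(1+\gamma)$ and $V(\gamma)=(\log_2 e)^2(1-(1+\gamma)^{-2})$. Let $Q^{-1}$ be the inverse of $Q(x)=\Pr(\mathcal N(0,1)>x)$. The lower bound on the data rate achieved by downlink channel training is $$R_d=\Big(1-\frac{T_{tr}}T\Big)\,\mathbb E\Big[C(\gamma_d)-\sqrt{\tfrac1T V(\gamma_d)}\;Q^{-1}(\epsilon)\Big].$$ **Theorem.** The entries of $\hat{\mathbf h}_d$ and $\hat{\mathbf e}_d$ have variances $\sigma^2_{\hat h_d}=\frac{\Lambda}{\Lambda+\sigma_u^2}$ and $\sigma^2_{\hat e_d}=\frac{\sigma_u^2}{\Lambda+\sigma_u^2}$. Let $$\gamma=\gamma^d_{\rm eff}=\frac{\rho_b\sigma^2_{\hat h_d}}{\rho_b\sigma^2_{\hat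 e_d}+1},$$ $$\Phi(\gamma,N_B)=\frac{e^{1/\gamma}}{\ln 2\;\Gamma(N_B)\,\gamma^{N_B}}\sum_{i=0}^{N_B-1}\binom{N_B-1}{i}(-1)^{N_B-1-i}\,G^{3,0}_{2,3}\Big(\begin{matrix}-i,-i\\0,-1-i,-1-i\end{matrix}\Big|\frac1\gamma\Big),$$ $$\Psi(\gamma,N_B,T)=\sqrt{\frac{2\pi}{T}}\,\frac{Q^{-1}(\epsilon)}{\Gamma(N_B)\ln 2}\,e^{-(N_B-1)}(N_B-1)^{N_B-\frac12}\sqrt{1-(1+\gamma(N_B-1))^{-2}},$$ where $G$ is Meijer's G-function. The expectations $\mathbb E[C(\gamma_d)]$ and $\mathbb E[\sqrt{V(\gamma_d)/T}\,Q^{-1}(\epsilon)]$ exist, and the capacity term is exactly $\mathbb E[C(\gamma_d)]=\Phi(\gamma^d_{\rm eff},N_B)$. The dispersion term is given by its Laplace approximation $\Psi$: there is an absolute constant $K>0$ such that, whenever $N_B\ge2$, there is a real $\delta$ with $|\delta|\le K/N_B$, $\ \mathbb E\big[\sqrt{V(\gamma_d)/T}\,Q^{-1}(\epsilon)\big]=(1+\delta)\,\Psi(\gamma^d_{\rm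 eff},N_B,T)$, and $$R_d=\Big(1-\frac{T_{tr}}{T}\Big)\Big[\Phi(\gamma^d_{\rm eff},N_B)-(1+\delta)\,\Psi(\gamma^d_{\rm eff},N_B,T)\Big].$$ Thus $R_d=(1-T_{tr}/T)\,[\Phi-\Psi]$ up to the relative error $O(1/N_B)$ of the Laplace approximation in $\Psi$, uniformly in all other parameters. -/

import Mathlib

open MeasureTheory ProbabilityTheory Matrix
open scoped NNReal ENNReal

noncomputable section

namespace ChannelTraining

/-! ### Meijer's G-function -/

/-- The Mellin–Barnes integrand of `G^{m,n}_{p,q}(z | a ; b)`: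
`∏_{j<m} Γ(b_j - s) ∏_{k<n} Γ(1 - a_k + s) / (∏_{j≥m} Γ(1 - b_j + s) ∏_{k≥n} Γ(a_k - s)) * z ^ s`. -/
def meijerGIntegrand {p q : ℕ} (m n : ℕ) (a : Fin p → ℂ) (b : Fin q → ℂ) (z s : ℂ) : ℂ :=
  ((∏ j : Fin q with j.val < m, Complex.Gamma (b j - s)) *
      ∏ k : Fin p with k.val < n, Complex.Gamma (1 - a k + s)) /
    ((∏ j : Fin q with m ≤ j.val, Complex.Gamma (1 - b j + s)) *
      ∏ k : Fin p with n ≤ k.val, Complex.Gamma (a k - s)) * z ^ s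

/-- The vertical line `Re s = c` separates the poles of the `Γ(b_j - s)`, `j < m` (to its right),
from the poles of the `Γ(1 - a_k + s)`, `k < n` (to its left). -/
def IsSeparatingLine {p q : ℕ} (m n : ℕ) (a : Fin p → ℂ) (b : Fin q → ℂ) (c : ℝ) : Prop :=
  (∀ j : Fin q, j.val < m → c < (b j).re) ∧ (∀ k : Fin p, k.val < n → (a k).re - 1 < c)

open Classical in
/-- Meijer's G-function `G^{m,n}_{p,q}(z | a ; b) = (1 / 2πi) ∫_L (integrand) ds`, the contour `L`
running from `-i∞` to `+i∞` and separating the two families of poles; here `L` is a vertical line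
`s = c + i t`, so that `ds / (2πi) = dt / (2π)`. The value does not depend on the choice
of the separating line, by Cauchy's theorem. (Junk value `0` if no vertical line separates.) -/
def meijerG {p q : ℕ} (m n : ℕ) (a : Fin p → ℂ) (b : Fin q → ℂ) (z : ℂ) : ℂ :=
  if h : ∃ c : ℝ, IsSeparatingLine m n a b c then
    (1 / (2 * (Real.pi : ℂ))) *
      ∫ t : ℝ, meijerGIntegrand m n a b z ((h.choose : ℂ) + (t : ℂ) * Complex.I)
  else 0

/-! ### Capacity, dispersion and the Q-function -/

/-- Channel capacity `C(γ) = log₂ (1 + γ)`. -/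
def capacity (γ : ℝ) : ℝ := Real.logb 2 (1 + γ)

/-- Channel dispersion `V(γ) = (log₂ e)² (1 - (1 + γ)⁻²)`. -/
def dispersion (γ : ℝ) : ℝ := (Real.logb 2 (Real.exp 1)) ^ 2 * (1 - ((1 + γ) ^ 2)⁻¹)

/-- The Gaussian Q-function: the upper tail probability of the standard normal law. -/
def gaussQ (x : ℝ) : ℝ := (gaussianReal 0 1).real (Set.Ioi x)

/-- The inverse Q-function; it is the true inverse of the bijection `gaussQ : ℝ → (0, 1)` on
`(0, 1)`. -/
def gaussQInv (ε : ℝ) : ℝ := Function.invFun gaussQ ε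

/-! ### The closed-form functions -/

/-- `Φ(γ, N)`, the closed form of the capacity term. (Complex-valued, as Meijer's G is.) -/
def Phi (γ : ℝ) (N : ℕ) : ℂ :=
  ((Real.exp (1 / γ) / (Real.log 2 * Real.Gamma N * γ ^ N) : ℝ) : ℂ) *
    ∑ i ∈ Finset.range N, ((N - 1).choose i : ℂ) * (-1) ^ (N - 1 - i) *
      meijerG 3 0 ![-(i : ℂ), -(i : ℂ)] ![0, -1 - (i : ℂ), -1 - (i : ℂ)] ((1 / γ : ℝ) : ℂ)

/-- `Ψ(γ, N, T)` (at error probability `ε`), the Laplace approximation of the dispersion term. -/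
def Psi (ε : ℝ) (γ : ℝ) (N T : ℕ) : ℝ :=
  Real.sqrt (2 * Real.pi / T) * (gaussQInv ε / (Real.Gamma N * Real.log 2)) *
    Real.exp (-((N : ℝ) - 1)) * ((N : ℝ) - 1) ^ ((N : ℝ) - 1 / 2) *
    Real.sqrt (1 - ((1 + γ * ((N : ℝ) - 1)) ^ 2)⁻¹)

/-! ### Random model of downlink training and data transmission -/

/-- The circularly symmetric complex Gaussian law `CN(0, v)`: independent real and imaginary
parts, each `N(0, v / 2)`. -/
def complexGaussian (v : ℝ≥0) : Measure ℂ :=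
  ((gaussianReal 0 (v / 2)).prod (gaussianReal 0 (v / 2))).map
    (fun p : ℝ × ℝ => (⟨p.1, p.2⟩ : ℂ))

/-- Variance `E|X - E X|²` of a complex random variable. -/
def complexVariance {Ω : Type*} [MeasurableSpace Ω] (X : Ω → ℂ) (μ : Measure Ω) : ℝ :=
  ∫ ω, ‖X ω - ∫ ω', X ω' ∂μ‖ ^ 2 ∂μ

/-- The squared Euclidean norm of a complex vector. -/
def sqNorm {N : ℕ} (x : Fin N → ℂ) : ℝ := ∑ j, ‖x j‖ ^ 2

/-- `Λ = T_tr P_b / N_B`. -/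
def pilotPower (N Ttr : ℕ) (P : ℝ) : ℝ := Ttr * P / N

/-- The received training signal `y_d = √Λ h_d S_d + n_d` at the user. -/
def trainingSignal {N Ttr : ℕ} (P : ℝ) (S : Matrix (Fin N) (Fin Ttr) ℂ)
    (h : Fin N → ℂ) (nd : Fin Ttr → ℂ) : Fin Ttr → ℂ :=
  ((Real.sqrt (pilotPower N Ttr P) : ℝ) : ℂ) • (h ᵥ* S) + nd

/-- The linear MMSE estimate `ĥ_d = (√Λ / (Λ + σ_u²)) y_d S_dᴴ`. -/
def estimate {N Ttr : ℕ} (P : ℝ) (σsq : ℝ≥0) (S : Matrix (Fin N) (Fin Ttr) ℂ)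
    (h : Fin N → ℂ) (nd : Fin Ttr → ℂ) : Fin N → ℂ :=
  ((Real.sqrt (pilotPower N Ttr P) / (pilotPower N Ttr P + σsq) : ℝ) : ℂ) •
    (trainingSignal P S h nd ᵥ* Sᴴ)

/-- The estimation error `ê_d = h_d - ĥ_d`. -/
def estimationError {N Ttr : ℕ} (P : ℝ) (σsq : ℝ≥0) (S : Matrix (Fin N) (Fin Ttr) ℂ)
    (h : Fin N → ℂ) (nd : Fin Ttr → ℂ) : Fin N → ℂ :=
  h - estimate P σsq S h nd

/-- The normalized beamforming vector matched to the estimated channel `x`, i.e. the column vector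
`xᴴ / ‖x‖`, for which `x v = ‖x‖`. -/
def beamformer {N : ℕ} (x : Fin N → ℂ) : Fin N → ℂ :=
  fun j => (starRingEnd ℂ) (x j) / ((Real.sqrt (sqNorm x) : ℝ) : ℂ)

/-- The effective noise `n̂ = √P_b ê_d v u + n` during data transmission: the received symbol is
`√P_b h_d v u + n = √P_b ‖ĥ_d‖ u + n̂`. -/
def effectiveNoise {N Ttr : ℕ} (P : ℝ) (σsq : ℝ≥0) (S : Matrix (Fin N) (Fin Ttr) ℂ)
    (h : Fin N → ℂ) (nd : Fin Ttr → ℂ) (u n : ℂ) : ℂ :=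
  ((Real.sqrt P : ℝ) : ℂ) *
    (estimationError P σsq S h nd ⬝ᵥ beamformer (estimate P σsq S h nd)) * u + n

/-- The random model: channel `h` with i.i.d. `CN(0,1)` entries, training noise `nd` with i.i.d.
`CN(0, σ_u²)` entries, information symbol `u` of unit average power and receiver noise
`n ~ CN(0, σ_u²)`, all independent; pilot matrix `S` with orthonormal rows. -/
structure IsDownlinkModel {Ω : Type*} [MeasurableSpace Ω] (μ : Measure Ω) {N Ttr : ℕ} (σsq : ℝ≥0)
    (S : Matrix (Fin N) (Fin Ttr) ℂ) (h : Ω → Fin N → ℂ) (nd : Ω → Fin Ttr → ℂ)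
    (u n : Ω → ℂ) : Prop where
  pilots : S * Sᴴ = 1
  law_h : HasLaw h (Measure.pi fun _ => complexGaussian 1) μ
  law_nd : HasLaw nd (Measure.pi fun _ => complexGaussian σsq) μ
  law_n : HasLaw n (complexGaussian σsq) μ
  meas_u : AEMeasurable u μ
  power_u : ∫ ω, ‖u ω‖ ^ 2 ∂μ = 1
  indep_nd : IndepFun h nd μ
  indep_u : IndepFun (fun ω => (h ω, nd ω)) u μ
  indep_n : IndepFun (fun ω => (h ω, nd ω, u ω)) n μ

/-- The SINR `γ_d = P_b ‖ĥ_d‖² / Var(n̂)` at the user, as a random variable. -/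
def sinr {Ω : Type*} [MeasurableSpace Ω] (μ : Measure Ω) {N Ttr : ℕ} (P : ℝ) (σsq : ℝ≥0)
    (S : Matrix (Fin N) (Fin Ttr) ℂ) (h : Ω → Fin N → ℂ) (nd : Ω → Fin Ttr → ℂ)
    (u n : Ω → ℂ) (ω : Ω) : ℝ :=
  P * sqNorm (estimate P σsq S (h ω) (nd ω)) /
    complexVariance (fun ω' => effectiveNoise P σsq S (h ω') (nd ω') (u ω') (n ω')) μ

/-- The lower bound on the data rate of downlink training,
`R_d = (1 - T_tr / T) E[C(γ_d) - √(V(γ_d) / T) Q⁻¹(ε)]`. -/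
def downlinkRate {Ω : Type*} [MeasurableSpace Ω] (μ : Measure Ω) {N Ttr : ℕ} (T : ℕ) (ε : ℝ)
    (P : ℝ) (σsq : ℝ≥0) (S : Matrix (Fin N) (Fin Ttr) ℂ) (h : Ω → Fin N → ℂ)
    (nd : Ω → Fin Ttr → ℂ) (u n : Ω → ℂ) : ℝ :=
  (1 - (Ttr : ℝ) / T) *
    ∫ ω, (capacity (sinr μ P σsq S h nd u n ω) -
      Real.sqrt (1 / (T : ℝ) * dispersion (sinr μ P σsq S h nd u n ω)) * gaussQInv ε) ∂μ

/-- `σ²_ĥ = Λ / (Λ + σ_u²)`. -/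
def estimateVar (N Ttr : ℕ) (P : ℝ) (σsq : ℝ≥0) : ℝ :=
  pilotPower N Ttr P / (pilotPower N Ttr P + σsq)

/-- `σ²_ê = σ_u² / (Λ + σ_u²)`. -/
def errorVar (N Ttr : ℕ) (P : ℝ) (σsq : ℝ≥0) : ℝ :=
  σsq / (pilotPower N Ttr P + σsq)

/-- The effective SNR `γ_eff = ρ_b σ²_ĥ / (ρ_b σ²_ê + 1)`, where `ρ_b = P_b / σ_u²`. -/
def effectiveSNR (N Ttr : ℕ) (P : ℝ) (σsq : ℝ≥0) : ℝ :=
  (P / σsq) * estimateVar N Ttr P σsq / ((P / σsq) * errorVar N Ttr P σsq + 1)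

end ChannelTraining

end

open ChannelTraining

namespace ChannelTraining

/-! The random model collapses to one Gamma variable. The estimate is `κ h + c n_d Sᴴ` with `κ =
σ²_ĥ`, and `Sᴴ` is isometric because the pilots are orthonormal. Estimate and error are therefore
jointly Gaussian and uncorrelated, hence independent with i.i.d. entries (`map_estimate_error`). The
beamformer is a unit vector depending on the estimate alone, so the projected error is again complex
Gaussian with the entrywise error variance (`map_dotProduct_beamformer`). This fixes the variance of
the effective noise, and the SINR is `γ_eff` times a `Γ(N, 1)` variable (`exists_sinr_eq`). Both
expectations become integrals over the half-line.

Capacity: the substitution `y = 1 + γ x` and the binomial expansion of `(y - 1) ^ (N - 1)` leave the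
integrals `logExpIntegral i (1 / γ)`. The Mellin transform of such an integral is `Γ(w) / (w - 1 -
i)²`, which at `w = -s` is the Mellin–Barnes integrand of the G-function in `Phi`. Mellin inversion
identifies the two (`meijerG_eq_logExpIntegral`).

Dispersion: the root dispersion is compared with its value at the mode `m = N - 1` of the Gamma
density. After division by that value it lies between a linear function of `x / m - 1` and the same
function minus a multiple of `(x / m - 1)²`, with coefficients bounded independently of `γ`
(`sqrtDispersion_bounds`). The first two Gamma moments turn this into a relative error `O(1 / m)`.
`Psi` is the value at the mode with `Γ(N) = m!` measured against Stirling's formula, which costs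
another factor `1 + O(1 / m)` (`exists_laplace_value_eq_Psi`). -/

lemma measurable_complexMk : Measurable (fun p : ℝ × ℝ => (⟨p.1, p.2⟩ : ℂ)) :=
  Complex.measurableEquivRealProd.symm.measurable

instance (v : ℝ≥0) : IsProbabilityMeasure (complexGaussian v) :=
  Measure.isProbabilityMeasure_map measurable_complexMk.aemeasurable

/-! ### Characteristic functions of complex Gaussian vectors. -/

lemma integral_exp_mul_gaussianReal (v : ℝ≥0) (t : ℝ) :
    ∫ x, Complex.exp (((t * x : ℝ) : ℂ) * Complex.I) ∂(gaussianReal 0 v)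
      = Complex.exp (-(v / 2) * t ^ 2) := by
  have h := charFun_gaussianReal (μ := 0) (v := v) t
  rw [charFun_apply_real] at h
  rw [show (-(v / 2 : ℂ) * (t : ℂ) ^ 2) = (t : ℂ) * ((0 : ℝ) : ℂ) * Complex.I
    - v * (t : ℂ) ^ 2 / 2 by push_cast; ring, ← h]
  push_cast
  rfl

/-- The independent real and imaginary parts have variance `v / 2`, so the two exponents add up to a
multiple of `‖a‖ ^ 2`. The phase of `a` drops out, which is circular symmetry. -/
lemma integral_exp_re_mul_complexGaussian (v : ℝ≥0) (a : ℂ) :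
    ∫ z, Complex.exp (((a * z).re : ℂ) * Complex.I) ∂(complexGaussian v)
      = Complex.exp (-(v / 4) * (‖a‖ ^ 2 : ℝ)) := by
  rw [complexGaussian, integral_map measurable_complexMk.aemeasurable
    (Measurable.aestronglyMeasurable (by fun_prop))]
  have : ∀ p : ℝ × ℝ, Complex.exp (((a * (⟨p.1, p.2⟩ : ℂ)).re : ℂ) * Complex.I)
      = Complex.exp (((a.re * p.1 : ℝ) : ℂ) * Complex.I)
        * Complex.exp (((-a.im * p.2 : ℝ) : ℂ) * Complex.I) := by
    intro p
    rw [← Complex.exp_add, Complex.mul_re]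
    push_cast
    ring_nf
  simp_rw [this]
  rw [integral_prod_mul (fun x : ℝ => Complex.exp (((a.re * x : ℝ) : ℂ) * Complex.I))
    (fun x : ℝ => Complex.exp (((-a.im * x : ℝ) : ℂ) * Complex.I)),
    integral_exp_mul_gaussianReal, integral_exp_mul_gaussianReal, ← Complex.exp_add,
    ← Complex.normSq_eq_norm_sq, Complex.normSq_apply]
  push_cast
  ring_nf

/-- The characteristic function of a vector with i.i.d. `CN(0, v)` entries. -/
lemma integral_exp_re_dotProduct {N : ℕ} (v : ℝ≥0) (a : Fin N → ℂ) :
    ∫ x, Complex.exp (((a ⬝ᵥ x).re : ℂ) * Complex.I)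
        ∂(Measure.pi fun _ : Fin N => complexGaussian v)
      = Complex.exp (-(v / 4) * (sqNorm a : ℝ)) := by
  have : ∀ x : Fin N → ℂ, Complex.exp (((a ⬝ᵥ x).re : ℂ) * Complex.I)
      = ∏ j, Complex.exp (((a j * x j).re : ℂ) * Complex.I) := by
    intro x
    rw [← Complex.exp_sum, ← Finset.sum_mul, dotProduct, Complex.re_sum, Complex.ofReal_sum]
  simp_rw [this]
  rw [integral_fintype_prod_eq_prod
    (f := fun j (z : ℂ) => Complex.exp (((a j * z).re : ℂ) * Complex.I))]
  simp_rw [integral_exp_re_mul_complexGaussian]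
  rw [← Complex.exp_sum, sqNorm, ← Finset.mul_sum, Complex.ofReal_sum]

/-- A real functional on `ℂⁿ` is the real part of a complex linear form. -/
lemma exists_eq_re_dotProduct {N : ℕ} (L : (Fin N → ℂ) →ₗ[ℝ] ℝ) :
    ∃ a : Fin N → ℂ, ∀ x, L x = (a ⬝ᵥ x).re := by
  refine ⟨fun j => ⟨L (Pi.single j 1), -L (Pi.single j Complex.I)⟩, fun x => ?_⟩
  have hx : x = ∑ j, ((x j).re • (Pi.single j 1 : Fin N → ℂ)
      + (x j).im • (Pi.single j Complex.I : Fin N → ℂ)) := by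
    ext k
    simp [Finset.sum_apply, Pi.single_apply, Finset.sum_add_distrib]
  conv_lhs => rw [hx]
  simp [dotProduct, Complex.re_sum, Complex.mul_re, mul_comm]

lemma exists_eq_re_mul (L : ℂ →ₗ[ℝ] ℝ) : ∃ a : ℂ, ∀ z, L z = (a * z).re := by
  refine ⟨⟨L 1, -L Complex.I⟩, fun z => ?_⟩
  have hz : z = z.re • (1 : ℂ) + z.im • Complex.I := by simp
  conv_lhs => rw [hz]
  rw [map_add, map_smul, map_smul]
  simp [Complex.mul_re, mul_comm]

lemma sqNorm_nonneg {N : ℕ} (x : Fin N → ℂ) : 0 ≤ sqNorm x :=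
  Finset.sum_nonneg fun _ _ => by positivity

lemma measurable_sqNorm {N : ℕ} : Measurable (sqNorm : (Fin N → ℂ) → ℝ) := by
  unfold sqNorm; fun_prop

/-- A fixed linear form of an i.i.d. circularly symmetric Gaussian vector is again such. -/
lemma map_dotProduct_complexGaussian {N : ℕ} (v w : ℝ≥0) (a : Fin N → ℂ)
    (hw : (w : ℝ) = v * sqNorm a) :
    (Measure.pi fun _ : Fin N => complexGaussian v).map (fun x => x ⬝ᵥ a)
      = complexGaussian w := by
  have hm : Measurable fun x : Fin N → ℂ => x ⬝ᵥ a := by unfold dotProduct; fun_prop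
  have := Measure.isProbabilityMeasure_map (μ := Measure.pi fun _ : Fin N => complexGaussian v)
    hm.aemeasurable
  refine Measure.ext_of_charFunDual (funext fun L => ?_)
  obtain ⟨b, hb⟩ := exists_eq_re_mul L.toLinearMap
  have hb' : ∀ z, L z = (b * z).re := hb
  simp_rw [charFunDual_apply, hb']
  rw [integral_map hm.aemeasurable (Measurable.aestronglyMeasurable (by fun_prop)),
    integral_exp_re_mul_complexGaussian]
  have : ∀ x : Fin N → ℂ, b * (x ⬝ᵥ a) = (b • a) ⬝ᵥ x := by
    intro x; rw [smul_dotProduct, dotProduct_comm, smul_eq_mul]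
  simp_rw [this]
  rw [integral_exp_re_dotProduct]
  have h2 : sqNorm (b • a) = ‖b‖ ^ 2 * sqNorm a := by
    simp [sqNorm, mul_pow, Finset.mul_sum]
  rw [h2]
  congr 1
  have : (w : ℂ) = v * (sqNorm a : ℝ) := by exact_mod_cast congrArg Complex.ofReal hw
  rw [this]
  push_cast
  ring

/-! ### First and second moments of the complex Gaussian law. -/

lemma integrable_sq_gaussianReal (v : ℝ≥0) :
    Integrable (fun x : ℝ => x ^ 2) (gaussianReal 0 v) :=
  (memLp_id_gaussianReal' (μ := 0) (v := v) 2 (by simp)).integrable_sq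

lemma integral_sq_gaussianReal (v : ℝ≥0) : ∫ x, x ^ 2 ∂(gaussianReal 0 v) = v := by
  have h := variance_id_gaussianReal (μ := 0) (v := v)
  rw [variance_eq_integral (by fun_prop)] at h
  simpa using h

lemma norm_sq_complexMk (p : ℝ × ℝ) : ‖(⟨p.1, p.2⟩ : ℂ)‖ ^ 2 = p.1 ^ 2 + p.2 ^ 2 := by
  rw [← Complex.normSq_eq_norm_sq, Complex.normSq_mk]; ring

lemma integrable_norm_sq_complexGaussian (v : ℝ≥0) :
    Integrable (fun z : ℂ => ‖z‖ ^ 2) (complexGaussian v) := by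
  rw [complexGaussian, integrable_map_measure (by fun_prop) measurable_complexMk.aemeasurable]
  simp only [Function.comp_def, norm_sq_complexMk]
  exact ((integrable_sq_gaussianReal _).comp_fst _).add ((integrable_sq_gaussianReal _).comp_snd _)

lemma integral_norm_sq_complexGaussian (v : ℝ≥0) :
    ∫ z, ‖z‖ ^ 2 ∂(complexGaussian v) = v := by
  rw [complexGaussian, integral_map measurable_complexMk.aemeasurable (by fun_prop)]
  simp only [norm_sq_complexMk]
  rw [integral_add ((integrable_sq_gaussianReal _).comp_fst _)
    ((integrable_sq_gaussianReal _).comp_snd _),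
    integral_fun_fst (fun x : ℝ => x ^ 2), integral_fun_snd (fun x : ℝ => x ^ 2),
    integral_sq_gaussianReal]
  simp

lemma memLp_complexGaussian (v : ℝ≥0) : MemLp (fun z : ℂ => z) 2 (complexGaussian v) :=
  (memLp_two_iff_integrable_sq_norm (by fun_prop)).2 (integrable_norm_sq_complexGaussian v)

lemma integral_complexGaussian (v : ℝ≥0) : ∫ z, z ∂(complexGaussian v) = 0 := by
  have hi : Integrable (fun z : ℂ => z) (complexGaussian v) :=
    (memLp_complexGaussian v).integrable (by norm_num)
  have hg : Integrable (fun x : ℝ => x) (gaussianReal 0 (v / 2)) :=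
    (memLp_id_gaussianReal' (μ := 0) (v := v / 2) 1 (by simp)).integrable (by simp)
  apply Complex.ext
  · rw [← RCLike.re_eq_complex_re, ← integral_re hi, complexGaussian,
      integral_map measurable_complexMk.aemeasurable (by fun_prop)]
    simp [integral_fun_fst (fun x : ℝ => x)]
  · rw [← RCLike.im_eq_complex_im, ← integral_im hi, complexGaussian,
      integral_map measurable_complexMk.aemeasurable (by fun_prop)]
    simp [integral_fun_snd (fun x : ℝ => x)]

/-! ### Independence of the estimate and its error. -/

lemma ofReal_sqNorm {N : ℕ} (x : Fin N → ℂ) : ((sqNorm x : ℝ) : ℂ) = star x ⬝ᵥ x := by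
  simp only [sqNorm, dotProduct, Complex.ofReal_sum, Pi.star_apply, Complex.star_def]
  exact Finset.sum_congr rfl fun j _ => by
    rw [← Complex.normSq_eq_conj_mul_self, Complex.normSq_eq_norm_sq]

/-- Orthonormal rows of `S` make `Sᴴ` an isometry, so correlating the noise with the pilots keeps it
white. -/
lemma sqNorm_conjTranspose_mulVec {N M : ℕ} {S : Matrix (Fin N) (Fin M) ℂ} (hS : S * Sᴴ = 1)
    (w : Fin N → ℂ) : sqNorm (Sᴴ *ᵥ w) = sqNorm w := by
  have : ((sqNorm (Sᴴ *ᵥ w) : ℝ) : ℂ) = (sqNorm w : ℝ) := by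
    rw [ofReal_sqNorm, ofReal_sqNorm, star_mulVec, conjTranspose_conjTranspose,
      ← dotProduct_mulVec, mulVec_mulVec, hS, one_mulVec]
  exact_mod_cast this

/-- The cross terms in `a` and `b` cancel. With `κ * η` as the weight of the projected noise, this
splits the joint characteristic function of estimate and error into a product. -/
lemma norm_sq_convex_combination {κ η : ℝ} (h : κ + η = 1) (a b : ℂ) :
    ‖b + κ * (a - b)‖ ^ 2 + κ * η * ‖a - b‖ ^ 2 = κ * ‖a‖ ^ 2 + η * ‖b‖ ^ 2 := by
  obtain rfl : η = 1 - κ := by linarith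
  simp only [← Complex.normSq_eq_norm_sq, Complex.normSq_apply, Complex.add_re, Complex.add_im,
    Complex.sub_re, Complex.sub_im, Complex.re_ofReal_mul, Complex.im_ofReal_mul]
  ring

/-- Orthogonality principle: the linear MMSE estimate and its error are independent i.i.d.
circularly symmetric Gaussian vectors. -/
lemma map_estimate_error {N M : ℕ} {S : Matrix (Fin N) (Fin M) ℂ} (hS : S * Sᴴ = 1)
    {κ η s : ℝ≥0} {c : ℝ} (hκη : (κ : ℝ) + η = 1) (hc : s * c ^ 2 = (κ : ℝ) * η) :
    ((Measure.pi fun _ : Fin N => complexGaussian 1).prod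
        (Measure.pi fun _ : Fin M => complexGaussian s)).map
      (fun p => ((κ : ℂ) • p.1 + (c : ℂ) • (p.2 ᵥ* Sᴴ),
        p.1 - ((κ : ℂ) • p.1 + (c : ℂ) • (p.2 ᵥ* Sᴴ))))
      = (Measure.pi fun _ : Fin N => complexGaussian κ).prod
        (Measure.pi fun _ : Fin N => complexGaussian η) := by
  have hm : Measurable fun p : (Fin N → ℂ) × (Fin M → ℂ) =>
      ((κ : ℂ) • p.1 + (c : ℂ) • (p.2 ᵥ* Sᴴ),
        p.1 - ((κ : ℂ) • p.1 + (c : ℂ) • (p.2 ᵥ* Sᴴ))) := by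
    have : Measurable fun x : Fin M → ℂ => x ᵥ* Sᴴ := by unfold vecMul dotProduct; fun_prop
    fun_prop
  have := Measure.isProbabilityMeasure_map
    (μ := (Measure.pi fun _ : Fin N => complexGaussian 1).prod
        (Measure.pi fun _ : Fin M => complexGaussian s)) hm.aemeasurable
  refine Measure.ext_of_charFunDual (funext fun L => ?_)
  obtain ⟨a, ha⟩ := exists_eq_re_dotProduct
    (L.toLinearMap ∘ₗ LinearMap.inl ℝ (Fin N → ℂ) (Fin N → ℂ))
  obtain ⟨b, hb⟩ := exists_eq_re_dotProduct
    (L.toLinearMap ∘ₗ LinearMap.inr ℝ (Fin N → ℂ) (Fin N → ℂ))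
  have hL : ∀ p, L p = (a ⬝ᵥ p.1).re + (b ⬝ᵥ p.2).re := by
    intro p
    rw [← ha, ← hb]
    simp [← map_add]
  simp_rw [charFunDual_apply, hL]
  have hmdot : ∀ {n : ℕ} (d : Fin n → ℂ), Measurable fun x : Fin n → ℂ => (d ⬝ᵥ x).re := by
    intro n d; unfold dotProduct; fun_prop
  have key : ∀ (d e : ℝ), Complex.exp (((d + e : ℝ) : ℂ) * Complex.I)
      = Complex.exp ((d : ℂ) * Complex.I) * Complex.exp ((e : ℂ) * Complex.I) := by
    intro d e; rw [← Complex.exp_add]; push_cast; ring_nf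
  rw [integral_map hm.aemeasurable]
  swap
  · refine Measurable.aestronglyMeasurable ?_
    have h1 : Measurable fun p : (Fin N → ℂ) × (Fin N → ℂ) => (a ⬝ᵥ p.1).re :=
      (hmdot a).comp measurable_fst
    have h2 : Measurable fun p : (Fin N → ℂ) × (Fin N → ℂ) => (b ⬝ᵥ p.2).re :=
      (hmdot b).comp measurable_snd
    exact Complex.measurable_exp.comp
      ((Complex.measurable_ofReal.comp (h1.add h2)).mul_const _)
  have hre : ∀ p : (Fin N → ℂ) × (Fin M → ℂ),
      (a ⬝ᵥ ((κ : ℂ) • p.1 + (c : ℂ) • (p.2 ᵥ* Sᴴ))).re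
        + (b ⬝ᵥ (p.1 - ((κ : ℂ) • p.1 + (c : ℂ) • (p.2 ᵥ* Sᴴ)))).re
      = ((b + (κ : ℂ) • (a - b)) ⬝ᵥ p.1).re + (((c : ℂ) • (Sᴴ *ᵥ (a - b))) ⬝ᵥ p.2).re := by
    intro p
    have : ∀ d : Fin N → ℂ, d ⬝ᵥ (p.2 ᵥ* Sᴴ) = (Sᴴ *ᵥ d) ⬝ᵥ p.2 := by
      intro d; rw [dotProduct_comm, ← dotProduct_mulVec, dotProduct_comm]
    rw [← Complex.add_re, ← Complex.add_re]
    congr 1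
    simp only [dotProduct_add, dotProduct_sub, dotProduct_smul, add_dotProduct, smul_dotProduct,
      sub_dotProduct, this, mulVec_sub, smul_eq_mul]
    ring
  simp_rw [hre, key]
  rw [integral_prod_mul
      (fun x : Fin N → ℂ => Complex.exp ((((b + (κ : ℂ) • (a - b)) ⬝ᵥ x).re : ℂ) * Complex.I))
      (fun x : Fin M → ℂ =>
        Complex.exp (((((c : ℂ) • (Sᴴ *ᵥ (a - b))) ⬝ᵥ x).re : ℂ) * Complex.I)),
    integral_prod_mul
      (fun x : Fin N → ℂ => Complex.exp (((a ⬝ᵥ x).re : ℂ) * Complex.I))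
      (fun x : Fin N → ℂ => Complex.exp (((b ⬝ᵥ x).re : ℂ) * Complex.I))]
  simp_rw [integral_exp_re_dotProduct, ← Complex.exp_add]
  have h1 : sqNorm ((c : ℂ) • (Sᴴ *ᵥ (a - b))) = c ^ 2 * sqNorm (a - b) := by
    rw [← sqNorm_conjTranspose_mulVec hS]
    simp [sqNorm, mul_pow, Finset.mul_sum]
  have h2 : sqNorm (b + (κ : ℂ) • (a - b)) + s * (c ^ 2 * sqNorm (a - b))
      = κ * sqNorm a + η * sqNorm b := by
    rw [← mul_assoc, hc]
    simp only [sqNorm, Finset.mul_sum, ← Finset.sum_add_distrib]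
    exact Finset.sum_congr rfl fun j _ => norm_sq_convex_combination hκη (a j) (b j)
  rw [h1]
  congr 1
  have h3 := congrArg Complex.ofReal h2
  push_cast at h3 ⊢
  linear_combination (-1 / 4 : ℂ) * h3

/-! ### Squared norm of a Gaussian vector -/

lemma integrableOn_pow_mul_exp_neg_mul {r : ℝ} (hr : 0 < r) (n : ℕ) :
    IntegrableOn (fun x : ℝ => x ^ n * Real.exp (-(r * x))) (Set.Ioi 0) := by
  have h := integrableOn_rpow_mul_exp_neg_mul_rpow (s := n) (p := 1) (b := r)
    (by linarith [n.cast_nonneg (α := ℝ)]) one_pos hr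
  simpa using h

lemma integrableOn_pow_mul_cexp_neg_mul {r : ℂ} (hr : 0 < r.re) (n : ℕ) :
    IntegrableOn (fun x : ℝ => (x : ℂ) ^ n * Complex.exp (-(r * x))) (Set.Ioi 0) := by
  refine (integrableOn_pow_mul_exp_neg_mul hr n).mono'
    (Measurable.aestronglyMeasurable (by fun_prop)) ?_
  filter_upwards [ae_restrict_mem measurableSet_Ioi] with x hx
  have hx0 : (0 : ℝ) < x := hx
  simp [Complex.norm_exp, abs_of_pos hx0]

/-- Integration by parts in `n`. A complex `r` is needed because the Gamma characteristic function
takes `r = 1 - t * I`. -/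
lemma integral_pow_mul_cexp_neg_mul {r : ℂ} (hr : 0 < r.re) (n : ℕ) :
    ∫ x in Set.Ioi (0 : ℝ), (x : ℂ) ^ n * Complex.exp (-(r * x)) = n.factorial / r ^ (n + 1) := by
  have hr0 : r ≠ 0 := by rintro rfl; simp at hr
  induction n with
  | zero =>
    have h := integral_exp_mul_complex_Ioi (a := -r) (by simpa using hr) 0
    simp only [neg_mul] at h
    simp [h, neg_div_neg_eq]
  | succ n ih =>
    have hder : ∀ x : ℝ, HasDerivAt
        (fun x : ℝ => -((x : ℂ) ^ (n + 1) * Complex.exp (-(r * x))) / r)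
        ((x : ℂ) ^ (n + 1) * Complex.exp (-(r * x))
          - (n + 1) / r * ((x : ℂ) ^ n * Complex.exp (-(r * x)))) x := by
      intro x
      have h1 : HasDerivAt (fun x : ℝ => (x : ℂ)) 1 x := Complex.ofRealCLM.hasDerivAt
      have h2 := (((h1.pow (n + 1)).mul ((h1.const_mul r).neg.cexp)).neg.div_const r)
      refine h2.congr_deriv ?_
      simp only [Nat.cast_add, Nat.cast_one, Nat.add_sub_cancel, mul_one, Pi.pow_apply, Pi.neg_apply]
      field_simp
      ring
    have hint := (integrableOn_pow_mul_cexp_neg_mul hr (n + 1)).sub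
      ((integrableOn_pow_mul_cexp_neg_mul hr n).const_mul ((n + 1) / r))
    have hlim : Filter.Tendsto (fun x : ℝ => -((x : ℂ) ^ (n + 1) * Complex.exp (-(r * x))) / r)
        Filter.atTop (nhds 0) := by
      rw [tendsto_zero_iff_norm_tendsto_zero]
      have h := (tendsto_rpow_mul_exp_neg_mul_atTop_nhds_zero ((n + 1 : ℕ) : ℝ) r.re hr).div_const ‖r‖
      rw [zero_div] at h
      refine h.congr' ?_
      filter_upwards [Filter.eventually_gt_atTop 0] with x hx
      rw [Real.rpow_natCast]
      simp [Complex.norm_exp, abs_of_pos hx]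
    have h := integral_Ioi_of_hasDerivAt_of_tendsto' (a := 0) (fun x _ => hder x) hint hlim
    rw [integral_sub (integrableOn_pow_mul_cexp_neg_mul hr (n + 1))
      ((integrableOn_pow_mul_cexp_neg_mul hr n).const_mul _), integral_const_mul, ih] at h
    simp only [Complex.ofReal_zero, ne_eq, Nat.add_eq_zero_iff, one_ne_zero, and_false,
      not_false_eq_true, zero_pow, zero_mul, neg_zero, zero_div, sub_zero] at h
    rw [sub_eq_zero.1 h, Nat.factorial_succ]
    push_cast
    field_simp
    ring

lemma integral_gammaMeasure {E : Type*} [NormedAddCommGroup E] [NormedSpace ℝ E] {N : ℕ}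
    (hN : 1 ≤ N) (f : ℝ → E) :
    ∫ x, f x ∂(gammaMeasure N 1)
      = ∫ x in Set.Ioi (0 : ℝ), ((Real.Gamma N)⁻¹ * (x ^ (N - 1) * Real.exp (-x))) • f x := by
  have hN0 : (0 : ℝ) < N := by exact_mod_cast hN
  have hpow : ∀ x : ℝ, x ^ ((N : ℝ) - 1) = x ^ (N - 1) := by
    intro x
    rw [← Real.rpow_natCast, Nat.cast_sub hN, Nat.cast_one]
  have hmeas : Measurable (gammaPDF N 1) := (measurable_gammaPDFReal N 1).ennreal_ofReal
  rw [gammaMeasure, integral_withDensity_eq_integral_toReal_smul hmeas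
    (ae_of_all _ fun _ => ENNReal.ofReal_lt_top),
    ← integral_Ici_eq_integral_Ioi, ← integral_indicator measurableSet_Ici]
  refine integral_congr_ae (ae_of_all _ fun x => ?_)
  simp only [gammaPDF, ENNReal.toReal_ofReal (gammaPDFReal_nonneg hN0 one_pos x)]
  by_cases hx : 0 ≤ x
  · simp [gammaPDFReal, hx, hpow, mul_assoc]
  · simp [gammaPDFReal, hx]

lemma charFun_gammaMeasure {N : ℕ} (hN : 1 ≤ N) (t : ℝ) :
    charFun (gammaMeasure N 1) t = ((1 - t * Complex.I)⁻¹) ^ N := by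
  obtain ⟨n, rfl⟩ : ∃ n, N = n + 1 := ⟨N - 1, by omega⟩
  have h := integral_pow_mul_cexp_neg_mul (r := 1 - t * Complex.I) (by simp) n
  rw [charFun_apply_real, integral_gammaMeasure hN, Nat.cast_add, Nat.cast_one,
    Real.Gamma_nat_eq_factorial, Nat.add_sub_cancel, inv_pow]
  have hf : (n.factorial : ℂ) ≠ 0 := by exact_mod_cast n.factorial_ne_zero
  rw [← inv_mul_cancel_left₀ hf (((1 - t * Complex.I) ^ (n + 1))⁻¹), ← div_eq_mul_inv (n.factorial : ℂ),
    ← h, ← integral_const_mul]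
  refine integral_congr_ae (ae_of_all _ fun x => ?_)
  have : Complex.exp (-((1 - t * Complex.I) * x))
      = Complex.exp (-x) * Complex.exp (t * x * Complex.I) := by
    rw [← Complex.exp_add]; ring_nf
  simp only [Complex.real_smul, this]
  push_cast
  ring

/-- The square stands for the real and imaginary parts together; it removes the complex square root
produced by the Gaussian integral. -/
lemma integral_exp_sq_gaussianReal {v : ℝ≥0} (hv : 0 < v) (t : ℝ) :
    (∫ x, Complex.exp (t * (x ^ 2 / v : ℝ) * Complex.I) ∂(gaussianReal 0 (v / 2))) ^ 2
      = (1 - t * Complex.I)⁻¹ := by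
  have hv' : (0 : ℝ) < v := hv
  have hre : 0 < ((1 - t * Complex.I) / (v : ℝ) : ℂ).re := by
    rw [Complex.div_ofReal_re]
    simpa using hv'
  have h := integral_gaussian_complex hre
  rw [integral_gaussianReal_eq_integral_smul (by positivity)]
  have : ∀ x : ℝ, gaussianPDFReal 0 (v / 2) x • Complex.exp (t * (x ^ 2 / v : ℝ) * Complex.I)
      = ((√(Real.pi * v))⁻¹ : ℝ) * Complex.exp (-((1 - t * Complex.I) / v) * x ^ 2) := by
    intro x
    rw [gaussianPDFReal, Complex.real_smul]
    push_cast
    rw [mul_assoc, ← Complex.exp_add]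
    have hvc : (v : ℂ) ≠ 0 := by exact_mod_cast hv.ne'
    have h2 : 2 * Real.pi * ((v : ℝ) / 2) = Real.pi * v := by ring
    rw [h2]
    congr 2
    field_simp
    ring
  simp_rw [this]
  rw [integral_const_mul, h, mul_pow, ← Complex.cpow_nat_mul]
  simp only [Nat.cast_ofNat, one_div, ne_eq, OfNat.ofNat_ne_zero, not_false_eq_true,
    mul_inv_cancel₀, Complex.cpow_one]
  rw [← Complex.ofReal_pow, inv_pow, Real.sq_sqrt (by positivity)]
  have hvc : (v : ℂ) ≠ 0 := by exact_mod_cast hv.ne'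
  have hpi : (Real.pi : ℂ) ≠ 0 := by exact_mod_cast Real.pi_ne_zero
  push_cast
  field_simp

lemma integral_exp_norm_sq_complexGaussian {v : ℝ≥0} (hv : 0 < v) (t : ℝ) :
    ∫ z, Complex.exp (t * (‖z‖ ^ 2 / v : ℝ) * Complex.I) ∂(complexGaussian v)
      = (1 - t * Complex.I)⁻¹ := by
  rw [complexGaussian, integral_map measurable_complexMk.aemeasurable
    (Measurable.aestronglyMeasurable (by fun_prop)), ← integral_exp_sq_gaussianReal hv t, sq,
    ← integral_prod_mul]
  refine integral_congr_ae (ae_of_all _ fun p => ?_)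
  simp only [norm_sq_complexMk, ← Complex.exp_add]
  push_cast
  ring_nf

/-- Each `‖x j‖ ^ 2 / v` has the characteristic function of a standard exponential variable; the
product of `N` of them is that of `Γ(N, 1)`. -/
lemma map_sqNorm_complexGaussian {N : ℕ} (hN : 1 ≤ N) {v : ℝ≥0} (hv : 0 < v) :
    (Measure.pi fun _ : Fin N => complexGaussian v).map (fun x => sqNorm x / v)
      = gammaMeasure N 1 := by
  have hm : Measurable fun x : Fin N → ℂ => sqNorm x / v := measurable_sqNorm.div_const _
  have := Measure.isProbabilityMeasure_map (μ := Measure.pi fun _ : Fin N => complexGaussian v)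
    hm.aemeasurable
  have := isProbabilityMeasure_gammaMeasure (a := N) (r := 1) (by exact_mod_cast hN) one_pos
  refine Measure.ext_of_charFun (funext fun t => ?_)
  rw [charFun_gammaMeasure hN, charFun_apply_real,
    integral_map hm.aemeasurable (Measurable.aestronglyMeasurable (by fun_prop))]
  have : ∀ x : Fin N → ℂ, Complex.exp (t * (sqNorm x / v : ℝ) * Complex.I)
      = ∏ j, Complex.exp (t * (‖x j‖ ^ 2 / v : ℝ) * Complex.I) := by
    intro x
    rw [← Complex.exp_sum, ← Finset.sum_mul, ← Finset.mul_sum, ← Complex.ofReal_sum,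
      ← Finset.sum_div, sqNorm]
  simp_rw [this]
  rw [integral_fintype_prod_eq_prod
    (f := fun _ (z : ℂ) => Complex.exp (t * (‖z‖ ^ 2 / v : ℝ) * Complex.I))]
  simp_rw [integral_exp_norm_sq_complexGaussian hv]
  simp

/-- This excludes the null event on which the beamformer is `0` instead of a unit vector. -/
lemma ae_sqNorm_ne_zero {N : ℕ} (hN : 1 ≤ N) {v : ℝ≥0} (hv : 0 < v) :
    ∀ᵐ x ∂(Measure.pi fun _ : Fin N => complexGaussian v), sqNorm x ≠ 0 := by
  have h : ∀ᵐ y ∂(gammaMeasure N 1), y ≠ 0 :=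
    (withDensity_absolutelyContinuous _ _).ae_le (Measure.ae_ne volume 0)
  rw [← map_sqNorm_complexGaussian hN hv] at h
  filter_upwards [ae_of_ae_map (measurable_sqNorm.div_const _).aemeasurable h] with x hx h0
  exact hx (by simp [h0])

/-- Projecting a Gaussian vector on an independent random direction does not change its variance. -/
lemma map_dotProduct_beamformer {N : ℕ} (hN : 1 ≤ N) {v : ℝ≥0} (hv : 0 < v) (w : ℝ≥0) :
    ((Measure.pi fun _ : Fin N => complexGaussian v).prod
        (Measure.pi fun _ : Fin N => complexGaussian w)).map (fun p => p.2 ⬝ᵥ beamformer p.1)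
      = complexGaussian w := by
  have hm : Measurable fun p : (Fin N → ℂ) × (Fin N → ℂ) => p.2 ⬝ᵥ beamformer p.1 := by
    have := measurable_sqNorm (N := N)
    unfold dotProduct beamformer
    fun_prop
  ext s hs
  rw [Measure.map_apply hm hs, Measure.prod_apply (hm hs)]
  -- By Fubini the direction `x` may be frozen: for almost every `x` the inner law is that of a
  -- fixed unit linear form.
  rw [lintegral_congr_ae (g := fun _ => complexGaussian w s)]
  · simp
  filter_upwards [ae_sqNorm_ne_zero hN hv] with x hx
  have hb : sqNorm (beamformer x) = 1 := by
    have hx0 := sqNorm_nonneg x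
    have : ∀ j, ‖beamformer x j‖ ^ 2 = ‖x j‖ ^ 2 / sqNorm x := by
      intro j
      simp [beamformer, div_pow, abs_of_nonneg (Real.sqrt_nonneg _), Real.sq_sqrt hx0]
    rw [sqNorm]
    simp_rw [this]
    rw [← Finset.sum_div]
    exact div_self hx
  have hmap := map_dotProduct_complexGaussian w w (beamformer x) (by rw [hb, mul_one])
  refine Eq.trans ?_ (DFunLike.congr_fun hmap s)
  rw [Measure.map_apply (by unfold dotProduct; fun_prop) hs]
  rfl

/-! ### Effective noise and SINR in the random model. -/

lemma pilotPower_pos {N Ttr : ℕ} {P : ℝ} (hN : 1 ≤ N) (hT : N ≤ Ttr) (hP : 0 < P) :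
    0 < pilotPower N Ttr P := by
  have h1 : (0 : ℝ) < N := by exact_mod_cast hN
  have h2 : (0 : ℝ) < Ttr := by exact_mod_cast hN.trans hT
  unfold pilotPower; positivity

lemma estimateVar_nonneg {N Ttr : ℕ} {P : ℝ} {σsq : ℝ≥0} (hΛ : 0 ≤ pilotPower N Ttr P) :
    0 ≤ estimateVar N Ttr P σsq :=
  div_nonneg hΛ (add_nonneg hΛ σsq.coe_nonneg)

lemma errorVar_nonneg {N Ttr : ℕ} {P : ℝ} {σsq : ℝ≥0} (hΛ : 0 ≤ pilotPower N Ttr P) :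
    0 ≤ errorVar N Ttr P σsq :=
  div_nonneg σsq.coe_nonneg (add_nonneg hΛ σsq.coe_nonneg)

section Model

variable {N Ttr : ℕ} {P : ℝ} {σsq : ℝ≥0} {Ω : Type*} [MeasurableSpace Ω] {μ : Measure Ω}
  {S : Matrix (Fin N) (Fin Ttr) ℂ} {h : Ω → Fin N → ℂ}
  {nd : Ω → Fin Ttr → ℂ} {u n : Ω → ℂ}

lemma estimate_eq (hS : S * Sᴴ = 1) (hΛ : 0 ≤ pilotPower N Ttr P) (x : Fin N → ℂ)
    (y : Fin Ttr → ℂ) :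
    estimate P σsq S x y = ((estimateVar N Ttr P σsq : ℝ) : ℂ) • x +
      ((Real.sqrt (pilotPower N Ttr P) / (pilotPower N Ttr P + σsq) : ℝ) : ℂ) • (y ᵥ* Sᴴ) := by
  rw [estimate, trainingSignal, add_vecMul, smul_vecMul, vecMul_vecMul, hS, vecMul_one, smul_add,
    smul_smul, ← Complex.ofReal_mul, div_mul_eq_mul_div, Real.mul_self_sqrt hΛ, estimateVar]

lemma measurable_estimate :
    Measurable fun p : (Fin N → ℂ) × (Fin Ttr → ℂ) => estimate P σsq S p.1 p.2 := by
  unfold estimate trainingSignal vecMul dotProduct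
  fun_prop

lemma measurable_estimationError :
    Measurable fun p : (Fin N → ℂ) × (Fin Ttr → ℂ) => estimationError P σsq S p.1 p.2 :=
  measurable_fst.sub measurable_estimate

lemma measurable_dotProduct_beamformer :
    Measurable fun p : (Fin N → ℂ) × (Fin N → ℂ) => p.2 ⬝ᵥ beamformer p.1 := by
  have := measurable_sqNorm (N := N)
  unfold dotProduct beamformer
  fun_prop

lemma complexVariance_of_hasLaw {X : Ω → ℂ} {v : ℝ≥0} (hX : HasLaw X (complexGaussian v) μ) :
    complexVariance X μ = v := by
  rw [complexVariance, hX.integral_eq, integral_complexGaussian, ← integral_norm_sq_complexGaussian]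
  simp only [sub_zero]
  exact hX.integral_comp (f := fun z : ℂ => ‖z‖ ^ 2) (by fun_prop)

lemma hasLaw_eval {v : ℝ≥0} (j : Fin N) :
    HasLaw (fun x : Fin N → ℂ => x j) (complexGaussian v)
      (Measure.pi fun _ => complexGaussian v) :=
  (measurePreserving_eval (fun _ => complexGaussian v) j).hasLaw

lemma memLp_of_hasLaw_complexGaussian {X : Ω → ℂ} {v : ℝ≥0}
    (hX : HasLaw X (complexGaussian v) μ) : MemLp X 2 μ := by
  have h := memLp_complexGaussian v
  rw [← hX.map_eq] at h
  exact h.comp_of_map hX.aemeasurable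

variable [IsProbabilityMeasure μ]

namespace IsDownlinkModel

lemma hasLaw_channel_noise (hm : IsDownlinkModel μ σsq S h nd u n) :
    HasLaw (fun ω => (h ω, nd ω)) ((Measure.pi fun _ => complexGaussian 1).prod
      (Measure.pi fun _ => complexGaussian σsq)) μ where
  aemeasurable := hm.law_h.aemeasurable.prodMk hm.law_nd.aemeasurable
  map_eq := by
    rw [(indepFun_iff_map_prod_eq_prod_map_map hm.law_h.aemeasurable hm.law_nd.aemeasurable).1
      hm.indep_nd, hm.law_h.map_eq, hm.law_nd.map_eq]

lemma hasLaw_estimate_error (hm : IsDownlinkModel μ σsq S h nd u n)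
    (hΛ : 0 < pilotPower N Ttr P) {κ η : ℝ≥0} (hκ : (κ : ℝ) = estimateVar N Ttr P σsq)
    (hη : (η : ℝ) = errorVar N Ttr P σsq) :
    HasLaw (fun ω => (estimate P σsq S (h ω) (nd ω), estimationError P σsq S (h ω) (nd ω)))
      ((Measure.pi fun _ => complexGaussian κ).prod (Measure.pi fun _ => complexGaussian η)) μ := by
  have hσ := σsq.coe_nonneg
  have hsum : (κ : ℝ) + η = 1 := by
    rw [hκ, hη, estimateVar, errorVar]; field_simp
  have hc : σsq * (Real.sqrt (pilotPower N Ttr P) / (pilotPower N Ttr P + σsq)) ^ 2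
      = (κ : ℝ) * η := by
    rw [div_pow, Real.sq_sqrt hΛ.le, hκ, hη, estimateVar, errorVar]; field_simp
  have hlaw : HasLaw (fun p : (Fin N → ℂ) × (Fin Ttr → ℂ) =>
      (estimate P σsq S p.1 p.2, estimationError P σsq S p.1 p.2))
      ((Measure.pi fun _ => complexGaussian κ).prod (Measure.pi fun _ => complexGaussian η))
      ((Measure.pi fun _ => complexGaussian 1).prod (Measure.pi fun _ => complexGaussian σsq)) :=
    { aemeasurable := (measurable_estimate.prodMk measurable_estimationError).aemeasurable
      map_eq := by
        refine Eq.trans ?_ (map_estimate_error hm.pilots hsum hc)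
        congr 1
        funext p
        rw [estimationError, estimate_eq hm.pilots hΛ.le, hκ] }
  have hcomp := HasLaw.comp hlaw hm.hasLaw_channel_noise
  simp only [Function.comp_def] at hcomp
  exact hcomp

end IsDownlinkModel

/-- The variance of a centred product plus independent centred noise. -/
lemma complexVariance_mul_add {D u n : Ω → ℂ} (hD : MemLp D 2 μ) (hu : MemLp u 2 μ)
    (hn : MemLp n 2 μ) (hDu : IndepFun D u μ) (hDun : IndepFun (fun ω => D ω * u ω) n μ)
    (hD0 : ∫ ω, D ω ∂μ = 0) (hn0 : ∫ ω, n ω ∂μ = 0) (c : ℂ) :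
    complexVariance (fun ω => c * D ω * u ω + n ω) μ
      = ‖c‖ ^ 2 * (∫ ω, ‖D ω‖ ^ 2 ∂μ) * (∫ ω, ‖u ω‖ ^ 2 ∂μ) + ∫ ω, ‖n ω‖ ^ 2 ∂μ := by
  have hDi := hD.integrable (by norm_num)
  have hui := hu.integrable (by norm_num)
  have hni := hn.integrable (by norm_num)
  have hDui : Integrable (fun ω => D ω * u ω) μ := hDu.integrable_mul hDi hui
  have hmean : ∫ ω, (c * D ω * u ω + n ω) ∂μ = 0 := by
    simp_rw [mul_assoc]
    rw [integral_add (hDui.const_mul c) hni, integral_const_mul,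
      hDu.integral_fun_mul_eq_mul_integral hD.1 hu.1, hD0, hn0]
    simp
  have hsq : IndepFun (fun ω => ‖D ω‖ ^ 2) (fun ω => ‖u ω‖ ^ 2) μ :=
    hDu.comp (φ := fun z : ℂ => ‖z‖ ^ 2) (ψ := fun z : ℂ => ‖z‖ ^ 2) (by fun_prop) (by fun_prop)
  have hD2 : Integrable (fun ω => ‖D ω‖ ^ 2) μ := (memLp_two_iff_integrable_sq_norm hD.1).1 hD
  have hu2 : Integrable (fun ω => ‖u ω‖ ^ 2) μ := (memLp_two_iff_integrable_sq_norm hu.1).1 hu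
  have hn2 : Integrable (fun ω => ‖n ω‖ ^ 2) μ := (memLp_two_iff_integrable_sq_norm hn.1).1 hn
  have hDu2 : Integrable (fun ω => ‖D ω‖ ^ 2 * ‖u ω‖ ^ 2) μ := hsq.integrable_mul hD2 hu2
  have hcross : IndepFun (fun ω => (starRingEnd ℂ) (D ω * u ω)) n μ :=
    hDun.comp (φ := fun z : ℂ => (starRingEnd ℂ) z) (ψ := fun z : ℂ => z)
      (by fun_prop) (by fun_prop)
  have hci : Integrable (fun ω => (starRingEnd ℂ) (D ω * u ω)) μ :=
    (Complex.conjCLE.toContinuousLinearMap.integrable_comp hDui)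
  have hcni : Integrable (fun ω => (starRingEnd ℂ) (D ω * u ω) * n ω) μ :=
    hcross.integrable_mul hci hni
  have hcn0 : ∫ ω, (starRingEnd ℂ) (D ω * u ω) * n ω ∂μ = 0 := by
    rw [hcross.integral_fun_mul_eq_mul_integral hci.1 hn.1, hn0, mul_zero]
  have hcn1 : Integrable (fun ω => (starRingEnd ℂ) c * ((starRingEnd ℂ) (D ω * u ω) * n ω)) μ :=
    hcni.const_mul _
  have hcn2 : ∫ ω, ((starRingEnd ℂ) c * ((starRingEnd ℂ) (D ω * u ω) * n ω)).re ∂μ = 0 := by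
    have := integral_re hcn1
    simp only [RCLike.re_eq_complex_re] at this
    rw [this, integral_const_mul, hcn0]
    simp
  have hexp : ∀ ω, ‖c * D ω * u ω + n ω‖ ^ 2 = ‖c‖ ^ 2 * (‖D ω‖ ^ 2 * ‖u ω‖ ^ 2)
      + 2 * ((starRingEnd ℂ) c * ((starRingEnd ℂ) (D ω * u ω) * n ω)).re + ‖n ω‖ ^ 2 := by
    intro ω
    rw [← Complex.normSq_eq_norm_sq, Complex.normSq_add, Complex.normSq_eq_norm_sq,
      Complex.normSq_eq_norm_sq, norm_mul, norm_mul, ← Complex.conj_re, map_mul, map_mul, map_mul,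
      Complex.conj_conj, map_mul]
    ring_nf
  have hre : Integrable
      (fun ω => ((starRingEnd ℂ) c * ((starRingEnd ℂ) (D ω * u ω) * n ω)).re) μ := hcn1.re
  rw [complexVariance, hmean]
  simp_rw [sub_zero, hexp]
  have hsum : Integrable (fun ω => ‖c‖ ^ 2 * (‖D ω‖ ^ 2 * ‖u ω‖ ^ 2)
      + 2 * ((starRingEnd ℂ) c * ((starRingEnd ℂ) (D ω * u ω) * n ω)).re) μ :=
    (hDu2.const_mul _).add (hre.const_mul 2)
  rw [integral_add hsum hn2,
    integral_add (hDu2.const_mul _) (hre.const_mul 2), integral_const_mul, integral_const_mul, hcn2,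
    hsq.integral_fun_mul_eq_mul_integral hD2.1 hu2.1]
  ring

namespace IsDownlinkModel

lemma complexVariance_effectiveNoise (hm : IsDownlinkModel μ σsq S h nd u n) (hN : 1 ≤ N)
    (hP : 0 ≤ P) (hΛ : 0 < pilotPower N Ttr P) :
    complexVariance (fun ω => effectiveNoise P σsq S (h ω) (nd ω) (u ω) (n ω)) μ
      = P * errorVar N Ttr P σsq + σsq := by
  have hσ := σsq.coe_nonneg
  obtain ⟨κ, hκ⟩ : ∃ κ : ℝ≥0, (κ : ℝ) = estimateVar N Ttr P σsq :=
    ⟨⟨_, estimateVar_nonneg hΛ.le⟩, rfl⟩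
  obtain ⟨η, hη⟩ : ∃ η : ℝ≥0, (η : ℝ) = errorVar N Ttr P σsq :=
    ⟨⟨_, errorVar_nonneg hΛ.le⟩, rfl⟩
  have hκ0 : 0 < κ := by
    rw [← NNReal.coe_pos, hκ]; unfold estimateVar; positivity
  let d : (Fin N → ℂ) × (Fin Ttr → ℂ) → ℂ := fun p =>
    estimationError P σsq S p.1 p.2 ⬝ᵥ beamformer (estimate P σsq S p.1 p.2)
  have hd : Measurable d :=
    measurable_dotProduct_beamformer.comp (measurable_estimate.prodMk measurable_estimationError)
  have hD : HasLaw (fun ω => d (h ω, nd ω)) (complexGaussian η) μ :=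
    HasLaw.fun_comp (Y := fun p : (Fin N → ℂ) × (Fin N → ℂ) => p.2 ⬝ᵥ beamformer p.1)
      ⟨measurable_dotProduct_beamformer.aemeasurable, map_dotProduct_beamformer hN hκ0 η⟩
      (hm.hasLaw_estimate_error hΛ hκ hη)
  have hu2 : MemLp u 2 μ := by
    refine (memLp_two_iff_integrable_sq_norm hm.meas_u.aestronglyMeasurable).2 ?_
    -- A non-integrable function has integral `0` by convention, so unit power already forces `u` to
    -- be square integrable.
    by_contra hni
    have := hm.power_u
    rw [integral_undef hni] at this
    exact zero_ne_one this
  have hDu : IndepFun (fun ω => d (h ω, nd ω)) u μ :=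
    hm.indep_u.comp (φ := d) (ψ := fun z => z) hd measurable_id
  have hDun : IndepFun (fun ω => d (h ω, nd ω) * u ω) n μ :=
    hm.indep_n.comp (φ := fun q : (Fin N → ℂ) × (Fin Ttr → ℂ) × ℂ => d (q.1, q.2.1) * q.2.2)
      (ψ := fun z => z) (by fun_prop) measurable_id
  have hvar := complexVariance_mul_add (memLp_of_hasLaw_complexGaussian hD) hu2
    (memLp_of_hasLaw_complexGaussian hm.law_n) hDu hDun
    (hD.integral_eq.trans (integral_complexGaussian η))
    (hm.law_n.integral_eq.trans (integral_complexGaussian σsq)) ((Real.sqrt P : ℝ) : ℂ)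
  have hsq : ∀ {X : Ω → ℂ} {v : ℝ≥0}, HasLaw X (complexGaussian v) μ →
      ∫ ω, ‖X ω‖ ^ 2 ∂μ = v := fun {X v} hX =>
    (hX.integral_comp (f := fun z : ℂ => ‖z‖ ^ 2) (by fun_prop)).trans
      (integral_norm_sq_complexGaussian v)
  rw [hsq hD, hsq hm.law_n, hm.power_u, hη] at hvar
  refine hvar.trans ?_
  rw [Complex.norm_real, Real.norm_eq_abs, sq_abs, Real.sq_sqrt hP, mul_one]

/-- The SINR is a `Γ(N, 1)` variable times the effective SNR. -/
lemma exists_sinr_eq (hm : IsDownlinkModel μ σsq S h nd u n) (hN : 1 ≤ N)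
    (hP : 0 < P) (hσ : 0 < σsq) (hΛ : 0 < pilotPower N Ttr P) :
    ∃ X : Ω → ℝ, HasLaw X (gammaMeasure N 1) μ ∧
      ∀ ω, sinr μ P σsq S h nd u n ω = effectiveSNR N Ttr P σsq * X ω := by
  have hσ' : (0 : ℝ) < σsq := hσ
  obtain ⟨κ, hκ⟩ : ∃ κ : ℝ≥0, (κ : ℝ) = estimateVar N Ttr P σsq :=
    ⟨⟨_, estimateVar_nonneg hΛ.le⟩, rfl⟩
  obtain ⟨η, hη⟩ : ∃ η : ℝ≥0, (η : ℝ) = errorVar N Ttr P σsq :=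
    ⟨⟨_, errorVar_nonneg hΛ.le⟩, rfl⟩
  have hκ0 : 0 < κ := by
    rw [← NNReal.coe_pos, hκ]; unfold estimateVar; positivity
  refine ⟨fun ω => sqNorm (estimate P σsq S (h ω) (nd ω)) / κ, ?_, fun ω => ?_⟩
  · have h1 : HasLaw (fun ω => estimate P σsq S (h ω) (nd ω))
        (Measure.pi fun _ => complexGaussian κ) μ :=
      measurePreserving_fst.fun_comp_hasLaw (hm.hasLaw_estimate_error hΛ hκ hη)
    exact HasLaw.fun_comp (Y := fun x : Fin N → ℂ => sqNorm x / κ)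
      ⟨(measurable_sqNorm.div_const _).aemeasurable, map_sqNorm_complexGaussian hN hκ0⟩ h1
  · rw [sinr, hm.complexVariance_effectiveNoise hN hP.le hΛ, effectiveSNR, ← hκ, ← hη]
    have : (0 : ℝ) < κ := hκ0
    have := η.coe_nonneg
    field_simp

end IsDownlinkModel

lemma effectiveSNR_pos (hP : 0 < P) (hσ : 0 < σsq) (hΛ : 0 < pilotPower N Ttr P) :
    0 < effectiveSNR N Ttr P σsq := by
  have hσ' : (0 : ℝ) < σsq := hσ
  unfold effectiveSNR estimateVar errorVar
  positivity

end Model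

/-! ### A Mellin pair -/

/-- The logarithmic exponential integral `∫₁^∞ yⁿ log y e^{-zy} dy`. -/
noncomputable def logExpIntegral (n : ℕ) (z : ℝ) : ℝ :=
  ∫ y in Set.Ioi (1 : ℝ), y ^ n * Real.log y * Real.exp (-(z * y))

lemma norm_pow_mul_log_mul_exp_le (n : ℕ) {z a y : ℝ} (hz : a ≤ z) (hy : 1 < y) :
    ‖y ^ n * Real.log y * Real.exp (-(z * y))‖ ≤ y ^ (n + 1) * Real.exp (-(a * y)) := by
  have hy0 : 0 < y := by linarith
  have hlog := Real.log_nonneg hy.le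
  have hlog' : Real.log y ≤ y := by linarith [Real.log_le_sub_one_of_pos hy0]
  rw [Real.norm_of_nonneg (by positivity), pow_succ]
  gcongr

lemma integrableOn_pow_mul_log_mul_exp (n : ℕ) {z : ℝ} (hz : 0 < z) :
    IntegrableOn (fun y : ℝ => y ^ n * Real.log y * Real.exp (-(z * y))) (Set.Ioi 1) := by
  refine Integrable.mono' ((integrableOn_pow_mul_exp_neg_mul hz (n + 1)).mono_set
    (Set.Ioi_subset_Ioi zero_le_one)) (Measurable.aestronglyMeasurable (by fun_prop)) ?_
  filter_upwards [ae_restrict_mem measurableSet_Ioi] with y hy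
  exact norm_pow_mul_log_mul_exp_le n le_rfl hy

/-- Mellin inversion is applied pointwise and needs continuity at the point. Near `z` the exponent
`z / 2` dominates. -/
lemma continuousAt_logExpIntegral (n : ℕ) {z : ℝ} (hz : 0 < z) :
    ContinuousAt (logExpIntegral n) z := by
  refine continuousAt_of_dominated (bound := fun y => y ^ (n + 1) * Real.exp (-(z / 2 * y)))
    (Filter.Eventually.of_forall fun x => Measurable.aestronglyMeasurable (by fun_prop)) ?_
    ((integrableOn_pow_mul_exp_neg_mul (half_pos hz) (n + 1)).mono_set
      (Set.Ioi_subset_Ioi zero_le_one))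
    (ae_of_all _ fun y => Continuous.continuousAt (by fun_prop))
  filter_upwards [lt_mem_nhds (half_lt_self hz)] with x hx
  filter_upwards [ae_restrict_mem measurableSet_Ioi] with y hy
  exact norm_pow_mul_log_mul_exp_le n hx.le hy

/-- The function is an antiderivative of `log y * y ^ (-p)` (`hasDerivAt_cpow_mul_log`); this is its
boundary value at infinity. -/
lemma tendsto_cpow_mul_log {p : ℂ} (hp : 1 < p.re) :
    Filter.Tendsto (fun y : ℝ => (y : ℂ) ^ (1 - p) * (Real.log y / (1 - p) - 1 / (1 - p) ^ 2))
      Filter.atTop (nhds 0) := by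
  have h1 : Filter.Tendsto (fun y : ℝ => y ^ (-(p.re - 1))) Filter.atTop (nhds 0) :=
    tendsto_rpow_neg_atTop (by linarith)
  have h2 : Filter.Tendsto (fun y : ℝ => Real.log y / y ^ (p.re - 1)) Filter.atTop (nhds 0) :=
    (isLittleO_log_rpow_atTop (by linarith)).tendsto_div_nhds_zero
  have h3 := (h2.mul_const (1 / ‖1 - p‖)).add (h1.mul_const (1 / ‖1 - p‖ ^ 2))
  simp only [zero_mul, add_zero] at h3
  refine squeeze_zero_norm' ?_ h3
  filter_upwards [Filter.eventually_ge_atTop 1] with y hy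
  have hy0 : (0 : ℝ) < y := by linarith
  rw [norm_mul, Complex.norm_cpow_eq_rpow_re_of_pos hy0]
  have hre : (1 - p).re = -(p.re - 1) := by simp
  have hn : ‖(Real.log y : ℂ) / (1 - p) - 1 / (1 - p) ^ 2‖
      ≤ Real.log y * (1 / ‖1 - p‖) + 1 / ‖1 - p‖ ^ 2 := by
    refine (norm_sub_le _ _).trans (le_of_eq ?_)
    rw [norm_div, norm_div, norm_pow, Complex.norm_real,
      Real.norm_of_nonneg (Real.log_nonneg hy), norm_one, div_eq_mul_one_div (Real.log y)]
  rw [hre]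
  refine (mul_le_mul_of_nonneg_left hn (by positivity)).trans (le_of_eq ?_)
  rw [mul_add, Real.rpow_neg hy0.le]
  ring

lemma hasDerivAt_cpow_mul_log {p : ℂ} (hp : 1 < p.re) {y : ℝ} (hy : 0 < y) :
    HasDerivAt (fun y : ℝ => (y : ℂ) ^ (1 - p) * (Real.log y / (1 - p) - 1 / (1 - p) ^ 2))
      (Real.log y * (y : ℂ) ^ (-p)) y := by
  have hp1 : 1 - p ≠ 0 := by
    intro h0
    have := congrArg Complex.re h0
    simp at this
    linarith
  have hyc : (y : ℂ) ≠ 0 := by exact_mod_cast hy.ne'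
  have h1 : HasDerivAt (fun y : ℝ => (y : ℂ) ^ (1 - p)) ((1 - p) * (y : ℂ) ^ (-p)) y := by
    have := (hasDerivAt_id (y : ℂ)).cpow_const (c := 1 - p) (by simp [hy])
    have := this.comp_ofReal
    refine this.congr_deriv ?_
    simp
  have h2 : HasDerivAt (fun y : ℝ => ((Real.log y : ℝ) : ℂ) / (1 - p) - 1 / (1 - p) ^ 2)
      (((y⁻¹ : ℝ) : ℂ) / (1 - p)) y :=
    ((Real.hasDerivAt_log hy.ne').ofReal_comp.div_const _).sub_const _
  refine (h1.mul h2).congr_deriv ?_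
  have h3 : (y : ℂ) ^ (1 - p) = y * (y : ℂ) ^ (-p) := by
    rw [sub_eq_add_neg, Complex.cpow_add _ _ hyc, Complex.cpow_one]
  rw [h3]
  push_cast
  field_simp
  ring

/-- A nonnegative derivative whose antiderivative converges is integrable, so the real part of the
complex antiderivative suffices. -/
lemma integrableOn_log_mul_rpow {p : ℝ} (hp : 1 < p) :
    IntegrableOn (fun y : ℝ => Real.log y * y ^ (-p)) (Set.Ioi 1) := by
  have hlim := (Complex.continuous_re.tendsto 0).comp
    (tendsto_cpow_mul_log (p := p) (by simpa using hp))
  refine integrableOn_Ioi_deriv_of_nonneg' (l := (0 : ℂ).re) (g := fun y : ℝ =>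
    ((y : ℂ) ^ (1 - (p : ℂ)) * (Real.log y / (1 - (p : ℂ)) - 1 / (1 - (p : ℂ)) ^ 2)).re) ?_ ?_ hlim
  · intro y hy
    have hy0 : (0 : ℝ) < y := lt_of_lt_of_le one_pos hy
    have h := hasDerivAt_cpow_mul_log (p := p) (by simpa using hp) hy0
    have h' := Complex.reCLM.hasFDerivAt.comp_hasDerivAt y h
    refine h'.congr_deriv ?_
    rw [← Complex.ofReal_neg, ← Complex.ofReal_cpow hy0.le, ← Complex.ofReal_mul]
    rfl
  · intro y hy
    have hy1 : (1 : ℝ) < y := hy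
    have := Real.log_nonneg hy1.le
    positivity

lemma integral_log_mul_cpow {p : ℂ} (hp : 1 < p.re) :
    ∫ y in Set.Ioi (1 : ℝ), (Real.log y * (y : ℂ) ^ (-p)) = 1 / (p - 1) ^ 2 := by
  have hint : IntegrableOn (fun y : ℝ => Real.log y * (y : ℂ) ^ (-p)) (Set.Ioi 1) := by
    refine Integrable.mono' (integrableOn_log_mul_rpow hp)
      (Measurable.aestronglyMeasurable (by fun_prop)) ?_
    filter_upwards [ae_restrict_mem measurableSet_Ioi] with y hy
    have hy1 : (1 : ℝ) < y := hy
    rw [norm_mul, Complex.norm_cpow_eq_rpow_re_of_pos (by linarith), Complex.norm_real,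
      Real.norm_of_nonneg (Real.log_nonneg hy1.le), Complex.neg_re]
  rw [integral_Ioi_of_hasDerivAt_of_tendsto'
    (fun y hy => hasDerivAt_cpow_mul_log hp (lt_of_lt_of_le one_pos hy)) hint
    (tendsto_cpow_mul_log hp)]
  simp only [Complex.ofReal_one, Complex.one_cpow, Real.log_one, Complex.ofReal_zero, zero_div,
    zero_sub, one_mul, sub_neg_eq_add, zero_add]
  rw [← neg_sub p 1, neg_sq]

/-- Integrating the norm over `z` leaves `Γ(Re w) * log y * y ^ (n - Re w)`. Its integrability at
infinity is where `n + 1 < Re w` comes from. -/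
lemma integrable_mellin_kernel (n : ℕ) {w : ℂ} (hw : n + 1 < w.re) :
    Integrable (Function.uncurry fun z y : ℝ =>
        (z : ℂ) ^ (w - 1) * ((y ^ n * Real.log y * Real.exp (-(z * y)) : ℝ) : ℂ))
      ((volume.restrict (Set.Ioi 0)).prod (volume.restrict (Set.Ioi 1))) := by
  have hn : (0 : ℝ) ≤ n := n.cast_nonneg
  have hw0 : 0 < w.re := by linarith
  have hmeas : Measurable (Function.uncurry fun z y : ℝ =>
        (z : ℂ) ^ (w - 1) * ((y ^ n * Real.log y * Real.exp (-(z * y)) : ℝ) : ℂ)) := by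
    unfold Function.uncurry
    fun_prop
  have hnorm : ∀ y ∈ Set.Ioi (1 : ℝ), ∀ z ∈ Set.Ioi (0 : ℝ),
      ‖(z : ℂ) ^ (w - 1) * ((y ^ n * Real.log y * Real.exp (-(z * y)) : ℝ) : ℂ)‖
        = (y ^ n * Real.log y) * (z ^ (w.re - 1) * Real.exp (-(y * z))) := by
    intro y hy z hz
    have hy1 : (1 : ℝ) < y := hy
    have hz0 : (0 : ℝ) < z := hz
    have := Real.log_nonneg hy1.le
    rw [norm_mul, Complex.norm_cpow_eq_rpow_re_of_pos hz0, Complex.norm_real,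
      Real.norm_of_nonneg (by positivity), Complex.sub_re, Complex.one_re, mul_comm z y]
    ring
  have hker : ∀ y ∈ Set.Ioi (1 : ℝ), IntegrableOn (fun z : ℝ =>
      (y ^ n * Real.log y) * (z ^ (w.re - 1) * Real.exp (-(y * z)))) (Set.Ioi 0) := by
    intro y hy
    have hy1 : (1 : ℝ) < y := hy
    have h := integrableOn_rpow_mul_exp_neg_mul_rpow (s := w.re - 1) (p := 1) (b := y)
      (by linarith) one_pos (by linarith)
    simp only [Real.rpow_one, neg_mul] at h
    exact h.const_mul _
  rw [integrable_prod_iff' hmeas.aestronglyMeasurable]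
  constructor
  · filter_upwards [ae_restrict_mem measurableSet_Ioi] with y hy
    refine Integrable.mono' (hker y hy)
      (hmeas.comp (measurable_id.prodMk measurable_const)).aestronglyMeasurable ?_
    filter_upwards [ae_restrict_mem measurableSet_Ioi] with z hz
    exact (hnorm y hy z hz).le
  · have hlog := (integrableOn_log_mul_rpow (p := w.re - n) (by linarith)).const_mul
      (Real.Gamma w.re)
    refine IntegrableOn.congr_fun hlog (fun y hy => ?_) measurableSet_Ioi
    have hy1 : (1 : ℝ) < y := hy
    have hy0 : (0 : ℝ) < y := by linarith
    simp only [Function.uncurry]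
    rw [setIntegral_congr_fun measurableSet_Ioi (hnorm y hy), integral_const_mul,
      Real.integral_rpow_mul_exp_neg_mul_Ioi hw0 hy0, neg_sub, Real.rpow_sub hy0,
      Real.rpow_natCast, one_div, Real.inv_rpow hy0.le]
    ring

lemma mellinConvergent_logExpIntegral (n : ℕ) {w : ℂ} (hw : n + 1 < w.re) :
    MellinConvergent (fun z => ((logExpIntegral n z : ℝ) : ℂ)) w := by
  have h := (integrable_mellin_kernel n hw).integral_prod_left
  refine IntegrableOn.congr_fun h (fun z _ => ?_) measurableSet_Ioi
  simp only [Function.uncurry]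
  rw [integral_const_mul, integral_complex_ofReal, logExpIntegral, smul_eq_mul]

/-- After exchanging the integrals, the `z`-integral gives `Γ(w) * y ^ (-w)`, and the logarithm
turns the remaining `y`-integral into a double pole at `w = n + 1`. -/
lemma mellin_logExpIntegral (n : ℕ) {w : ℂ} (hw : n + 1 < w.re) :
    mellin (fun z => ((logExpIntegral n z : ℝ) : ℂ)) w = Complex.Gamma w / (w - 1 - n) ^ 2 := by
  have hn : (0 : ℝ) ≤ n := n.cast_nonneg
  have hw0 : 0 < w.re := by linarith
  have h1 : ∀ z : ℝ, (z : ℂ) ^ (w - 1) • ((logExpIntegral n z : ℝ) : ℂ)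
      = ∫ y in Set.Ioi (1 : ℝ),
        (z : ℂ) ^ (w - 1) * ((y ^ n * Real.log y * Real.exp (-(z * y)) : ℝ) : ℂ) := by
    intro z
    rw [integral_const_mul, integral_complex_ofReal, logExpIntegral, smul_eq_mul]
  rw [mellin]
  simp_rw [h1]
  rw [integral_integral_swap (integrable_mellin_kernel n hw)]
  have h2 : ∀ y ∈ Set.Ioi (1 : ℝ), ∫ z in Set.Ioi (0 : ℝ),
      (z : ℂ) ^ (w - 1) * ((y ^ n * Real.log y * Real.exp (-(z * y)) : ℝ) : ℂ)
      = Complex.Gamma w * (Real.log y * (y : ℂ) ^ (-(w - n))) := by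
    intro y hy
    have hy1 : (1 : ℝ) < y := hy
    have hy0 : (0 : ℝ) < y := by linarith
    have hyc : (y : ℂ) ≠ 0 := by exact_mod_cast hy0.ne'
    have h3 := Complex.integral_cpow_mul_exp_neg_mul_Ioi hw0 hy0
    have h4 : (1 / (y : ℂ)) ^ w = (y : ℂ) ^ (-w) := by
      rw [one_div, Complex.inv_cpow _ _ (by
        rw [Complex.arg_ofReal_of_nonneg hy0.le]; exact Real.pi_ne_zero.symm), Complex.cpow_neg]
    rw [neg_sub, Complex.cpow_sub _ _ hyc, Complex.cpow_natCast]
    calc _ = ∫ z in Set.Ioi (0 : ℝ), ((y : ℂ) ^ n * Real.log y) *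
          ((z : ℂ) ^ (w - 1) * Complex.exp (-(y * z))) := by
          refine integral_congr_ae (ae_of_all _ fun z => ?_)
          push_cast
          rw [mul_comm (z : ℂ) y]
          ring
      _ = _ := by
          rw [integral_const_mul, h3, h4, Complex.cpow_neg]
          ring
  rw [setIntegral_congr_fun measurableSet_Ioi h2, integral_const_mul,
    integral_log_mul_cpow (by simpa using by linarith)]
  rw [show w - n - 1 = w - 1 - n by ring]
  ring

lemma norm_Gamma_le_Gamma_re {w : ℂ} (hw : 0 < w.re) : ‖Complex.Gamma w‖ ≤ Real.Gamma w.re := by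
  rw [Complex.Gamma_eq_integral hw, Complex.GammaIntegral, Real.Gamma_eq_integral hw]
  refine (norm_integral_le_integral_norm _).trans (le_of_eq ?_)
  refine setIntegral_congr_fun measurableSet_Ioi fun x hx => ?_
  have hx0 : (0 : ℝ) < x := hx
  rw [norm_mul, Complex.norm_cpow_eq_rpow_re_of_pos hx0, Complex.norm_real,
    Real.norm_of_nonneg (Real.exp_pos _).le, Complex.sub_re, Complex.one_re]

/-- The squared denominator alone provides enough decay, so bounding `Γ` on the line by `Γ(σ)` is
sufficient. -/
lemma verticalIntegrable_mellin_logExpIntegral (n : ℕ) {σ : ℝ} (hσ : n + 1 < σ) :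
    Complex.VerticalIntegrable (mellin fun z => ((logExpIntegral n z : ℝ) : ℂ)) σ := by
  have hn : (0 : ℝ) ≤ n := n.cast_nonneg
  have hσ0 : 0 < σ := by linarith
  have heq : ∀ t : ℝ, mellin (fun z => ((logExpIntegral n z : ℝ) : ℂ)) (σ + t * Complex.I)
      = Complex.Gamma (σ + t * Complex.I) / (σ + t * Complex.I - 1 - n) ^ 2 :=
    fun t => mellin_logExpIntegral n (by simpa using hσ)
  have hcont : Continuous fun t : ℝ => Complex.Gamma (σ + t * Complex.I) := by
    refine continuous_iff_continuousAt.2 fun t => ?_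
    have hd : DifferentiableAt ℂ Complex.Gamma (σ + t * Complex.I) := by
      refine Complex.differentiableAt_Gamma _ fun m hm => ?_
      have := congrArg Complex.re hm
      simp only [Complex.add_re, Complex.ofReal_re, Complex.mul_re, Complex.I_re, mul_zero,
        Complex.ofReal_im, Complex.I_im, mul_one, sub_self, add_zero, Complex.neg_re,
        Complex.natCast_re] at this
      linarith [m.cast_nonneg (α := ℝ)]
    exact ContinuousAt.comp (f := fun t : ℝ => (σ + t * Complex.I : ℂ)) hd.continuousAt
      (Continuous.continuousAt (by fun_prop))
  rw [Complex.VerticalIntegrable]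
  simp_rw [heq]
  have ha : 0 < σ - 1 - n := by linarith
  -- With `a = σ - 1 - n`, the constant comes from `1 + t² ≤ (1 + 1 / a²) * (a² + t²)`.
  refine Integrable.mono' (integrable_inv_one_add_sq.const_mul
    (Real.Gamma σ * (1 + 1 / (σ - 1 - n) ^ 2)))
    (hcont.measurable.div (by fun_prop)).aestronglyMeasurable (ae_of_all _ fun t => ?_)
  have h1 : ‖(σ + t * Complex.I - 1 - n : ℂ)‖ ^ 2 = (σ - 1 - n) ^ 2 + t ^ 2 := by
    rw [← Complex.normSq_eq_norm_sq, Complex.normSq_apply]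
    simp
    ring
  have h2 : ‖Complex.Gamma (σ + t * Complex.I)‖ ≤ Real.Gamma σ := by
    have := norm_Gamma_le_Gamma_re (w := σ + t * Complex.I) (by simpa using hσ0)
    simpa using this
  rw [norm_div, norm_pow, h1]
  have hG := Real.Gamma_pos_of_pos hσ0
  rw [div_le_iff₀ (by positivity), mul_assoc, mul_assoc]
  refine h2.trans (le_mul_of_one_le_right hG.le ?_)
  rw [inv_mul_eq_div, ← mul_div_assoc, one_le_div (by positivity), one_add_mul, one_div,
    inv_mul_eq_div, add_div, div_self (by positivity)]
  have : 0 ≤ t ^ 2 / (σ - 1 - n) ^ 2 := by positivity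
  nlinarith [sq_nonneg (σ - 1 - n)]

/-- The recurrence `Γ(x + 1) = x Γ(x)` at `x = -1 - n - s` collapses the quotient of the repeated
Gamma factors to a double pole. -/
lemma meijerGIntegrand_eq (n : ℕ) {z : ℝ} {s : ℂ} (hs : s.re < -1 - n) :
    meijerGIntegrand 3 0 ![-(n : ℂ), -(n : ℂ)] ![0, -1 - (n : ℂ), -1 - (n : ℂ)] (z : ℂ) s
      = (z : ℂ) ^ s * (Complex.Gamma (-s) / (-s - 1 - n) ^ 2) := by
  have hre : 0 < (-1 - n - s : ℂ).re := by simp; linarith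
  have hne : (-1 - n - s : ℂ) ≠ 0 := by
    intro h0; rw [h0] at hre; simp at hre
  have hG : Complex.Gamma (-1 - n - s) ≠ 0 := Complex.Gamma_ne_zero_of_re_pos hre
  have hrec : Complex.Gamma (-n - s) = (-1 - n - s) * Complex.Gamma (-1 - n - s) := by
    rw [← Complex.Gamma_add_one _ hne]
    ring_nf
  have h3 : (Finset.univ.filter fun j : Fin 3 => j.val < 3) = Finset.univ := by decide
  have h4 : (Finset.univ.filter fun j : Fin 3 => 3 ≤ j.val) = ∅ := by decide
  have h5 : (Finset.univ.filter fun j : Fin 2 => j.val < 0) = ∅ := by decide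
  have h6 : (Finset.univ.filter fun j : Fin 2 => 0 ≤ j.val) = Finset.univ := by decide
  rw [meijerGIntegrand, h3, h4, h5, h6, Fin.prod_univ_three, Fin.prod_univ_two]
  simp only [Matrix.cons_val_zero, Matrix.cons_val_one, Matrix.cons_val_two, Matrix.head_cons,
    Matrix.tail_cons, Finset.prod_empty, mul_one, one_mul, zero_sub]
  rw [hrec, show (-s - 1 - n : ℂ) = -1 - n - s by ring]
  field_simp

lemma meijerG_eq_logExpIntegral (n : ℕ) {z : ℝ} (hz : 0 < z) :
    meijerG 3 0 ![-(n : ℂ), -(n : ℂ)] ![0, -1 - (n : ℂ), -1 - (n : ℂ)] (z : ℂ)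
      = (logExpIntegral n z : ℝ) := by
  have hex : ∃ c : ℝ, IsSeparatingLine 3 0 ![-(n : ℂ), -(n : ℂ)]
      ![0, -1 - (n : ℂ), -1 - (n : ℂ)] c := by
    refine ⟨-2 - n, fun j _ => ?_, fun k hk => absurd hk (Nat.not_lt_zero _)⟩
    have hn : (0 : ℝ) ≤ n := n.cast_nonneg
    fin_cases j <;> simp
    linarith
  rw [meijerG, dif_pos hex]
  -- The abscissa chosen in `meijerG` is unspecified, but every separating line has `c < -1 - n`, so
  -- `-c` lies in the half-plane of convergence.
  obtain ⟨hc, -⟩ := hex.choose_spec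
  generalize hex.choose = c at hc ⊢
  have hc1 : c < -1 - n := by simpa using hc 1 (by decide)
  have hσ : n + 1 < -c := by linarith
  have hinv := mellinInv_mellin_eq (-c) (fun z => ((logExpIntegral n z : ℝ) : ℂ)) hz
    (mellinConvergent_logExpIntegral n (by simpa using hσ))
    (verticalIntegrable_mellin_logExpIntegral n hσ)
    (Complex.continuous_ofReal.continuousAt.comp (continuousAt_logExpIntegral n hz))
  -- The two contours correspond under `s = -w`, hence the reflection of `t`.
  rw [← hinv, mellinInv, ← integral_neg_eq_self, Complex.real_smul]
  congr 1
  · push_cast; rfl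
  refine integral_congr_ae (ae_of_all _ fun t => ?_)
  simp only
  rw [meijerGIntegrand_eq n (by simpa using hc1),
    mellin_logExpIntegral n (by simpa using hσ), smul_eq_mul]
  push_cast
  ring_nf

/-! ### Capacity term -/

lemma setIntegral_Ioi_comp_one_add_mul {γ : ℝ} (hγ : 0 < γ) (g : ℝ → ℝ) :
    ∫ x in Set.Ioi (0 : ℝ), g (1 + γ * x) = γ⁻¹ * ∫ y in Set.Ioi (1 : ℝ), g y := by
  have h1 := integral_comp_mul_left_Ioi (fun t => g (1 + t)) 0 hγ
  rw [h1, mul_zero, smul_eq_mul]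
  congr 1
  rw [← integral_indicator measurableSet_Ioi, ← integral_indicator measurableSet_Ioi,
    ← integral_add_left_eq_self (Set.indicator (Set.Ioi 1) g) (1 : ℝ)]
  refine integral_congr_ae (ae_of_all _ fun t => ?_)
  simp [Set.indicator_apply]

lemma setIntegral_sub_one_pow_mul_log {γ : ℝ} (hγ : 0 < γ) (m : ℕ) :
    ∫ y in Set.Ioi (1 : ℝ), (y - 1) ^ m * Real.log y * Real.exp (-(1 / γ * y))
      = ∑ i ∈ Finset.range (m + 1), (m.choose i : ℝ) * (-1) ^ (m - i)
        * logExpIntegral i (1 / γ) := by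
  have hz : 0 < 1 / γ := by positivity
  simp_rw [logExpIntegral, ← integral_const_mul]
  rw [← integral_finsetSum]
  · refine integral_congr_ae (ae_of_all _ fun y => ?_)
    simp only [sub_eq_add_neg y, add_pow, Finset.sum_mul]
    exact Finset.sum_congr rfl fun i _ => by ring
  · intro i _
    exact (integrableOn_pow_mul_log_mul_exp i hz).const_mul _

lemma integral_capacity_gammaMeasure {N : ℕ} (hN : 1 ≤ N) {γ : ℝ} (hγ : 0 < γ) :
    ((∫ x, capacity (γ * x) ∂(gammaMeasure N 1) : ℝ) : ℂ) = Phi γ N := by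
  obtain ⟨m, rfl⟩ : ∃ m, N = m + 1 := ⟨N - 1, by omega⟩
  have hz : 0 < 1 / γ := by positivity
  have hlog : Real.log 2 ≠ 0 := (Real.log_pos one_lt_two).ne'
  have hreal : ∫ x, capacity (γ * x) ∂(gammaMeasure (m + 1 : ℕ) 1)
      = Real.exp (1 / γ) / (Real.log 2 * Real.Gamma (m + 1 : ℕ) * γ ^ (m + 1)) *
        ∑ i ∈ Finset.range (m + 1), (m.choose i : ℝ) * (-1) ^ (m - i)
        * logExpIntegral i (1 / γ) := by
    rw [integral_gammaMeasure hN, ← setIntegral_sub_one_pow_mul_log hγ]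
    have hsub := setIntegral_Ioi_comp_one_add_mul hγ
      (fun y => (y - 1) ^ m * Real.log y * Real.exp (-(1 / γ * y)))
    rw [← (eq_inv_mul_iff_mul_eq₀ hγ.ne').1 hsub, ← integral_const_mul, ← integral_const_mul]
    refine integral_congr_ae (ae_of_all _ fun x => ?_)
    -- The shift by `1` is the source of the prefactor `e^{1/γ}` in `Phi`.
    have hexp : Real.exp (-(1 / γ * (1 + γ * x))) = Real.exp (-x) / Real.exp (1 / γ) := by
      rw [← Real.exp_sub]; congr 1; field_simp; ring
    simp only [smul_eq_mul, Nat.add_sub_cancel, capacity, Real.logb, hexp, add_sub_cancel_left,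
      mul_pow]
    have hG : Real.Gamma (m + 1 : ℕ) ≠ 0 :=
      (Real.Gamma_pos_of_pos (by exact_mod_cast hN)).ne'
    field_simp
    ring_nf
  rw [hreal, Phi]
  push_cast
  congr 1
  refine Finset.sum_congr rfl fun i _ => ?_
  have := meijerG_eq_logExpIntegral i hz
  push_cast at this
  rw [this]

/-! ### Moments of the Gamma distribution -/

lemma integral_pow_gammaMeasure (m k : ℕ) :
    ∫ x, x ^ k ∂(gammaMeasure (m + 1 : ℕ) 1) = ((m + k).factorial : ℝ) / m.factorial := by
  rw [integral_gammaMeasure (by omega)]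
  have h := Real.Gamma_eq_integral (s := (m + k : ℕ) + 1) (by positivity)
  rw [Real.Gamma_nat_eq_factorial] at h
  rw [Nat.cast_add, Nat.cast_one, Real.Gamma_nat_eq_factorial, h, div_eq_inv_mul,
    ← integral_const_mul]
  refine integral_congr_ae (ae_of_all _ fun x => ?_)
  simp only [smul_eq_mul, add_sub_cancel_right, Real.rpow_natCast, Nat.add_sub_cancel, pow_add]
  ring

/-- A non-integrable power would have integral `0` by convention, against the positive value already
computed. -/
lemma integrable_pow_gammaMeasure (m k : ℕ) :
    Integrable (fun x : ℝ => x ^ k) (gammaMeasure (m + 1 : ℕ) 1) := by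
  by_contra hni
  have h := integral_pow_gammaMeasure m k
  rw [integral_undef hni] at h
  have : 0 < ((m + k).factorial : ℝ) / m.factorial := by positivity
  exact this.ne h

lemma ae_nonneg_gammaMeasure (a r : ℝ) : ∀ᵐ x ∂(gammaMeasure a r), 0 ≤ x := by
  have hmeas : Measurable (gammaPDF a r) := (measurable_gammaPDFReal a r).ennreal_ofReal
  rw [gammaMeasure, ae_withDensity_iff hmeas]
  refine ae_of_all _ fun x hx => ?_
  by_contra hneg
  exact hx (gammaPDF_of_neg (not_le.1 hneg))

/-! ### Laplace approximation -/

/-- Here `t` will be `γ` times the mode and `r` the position relative to the mode; the deviation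
from `1` is factored through `r - 1`. -/
lemma one_sub_inv_sq_ratio {t r : ℝ} (ht : 0 < t) (hr : 0 ≤ r) :
    (1 - ((1 + t * r) ^ 2)⁻¹) / (1 - ((1 + t) ^ 2)⁻¹)
      = 1 + (r - 1) * ((2 + t + t * r) / ((1 + t * r) ^ 2 * (2 + t))) := by
  have h1 : 0 < 1 + t * r := by positivity
  have h2 : 1 - ((1 + t) ^ 2)⁻¹ = t * (2 + t) / (1 + t) ^ 2 := by field_simp; ring
  rw [h2]
  field_simp
  ring

/-- `a` is the slope of `D` at `r = 1`, so the last two bounds compare `D` with its tangent. The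
constants `1` and `2` are free of `t`, which gives uniformity in `γ`. -/
lemma ratio_sub_one_bounds {t r : ℝ} (ht : 0 < t) (hr : 0 ≤ r) :
    let D := (r - 1) * ((2 + t + t * r) / ((1 + t * r) ^ 2 * (2 + t)))
    let a := 2 / ((1 + t) * (2 + t))
    D ^ 2 ≤ (r - 1) ^ 2 ∧ D ≤ a * (r - 1) ∧ a * (r - 1) - 2 * (r - 1) ^ 2 ≤ D := by
  intro D a
  have hA : 0 < 1 + t * r := by positivity
  have htr : 0 ≤ t * r := by positivity
  have hdiff : D - a * (r - 1) = -((r - 1) ^ 2 *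
      (t * (1 + t + 2 * (1 + t * r)) / ((1 + t) * (1 + t * r) ^ 2 * (2 + t)))) := by
    simp only [D, a]
    field_simp
    ring
  have hc0 : 0 ≤ t * (1 + t + 2 * (1 + t * r)) / ((1 + t) * (1 + t * r) ^ 2 * (2 + t)) := by
    positivity
  have hc2 : t * (1 + t + 2 * (1 + t * r)) / ((1 + t) * (1 + t * r) ^ 2 * (2 + t)) ≤ 2 := by
    rw [div_le_iff₀ (by positivity)]
    have h1 : 1 ≤ (1 + t * r) ^ 2 := by nlinarith
    have h2 : 1 + t * r ≤ (1 + t * r) ^ 2 := by nlinarith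
    have h3 : t * (1 + t + 2 * (1 + t * r)) ≤ (1 + t) * (1 + t + 2 * (1 + t * r)) := by
      gcongr; linarith
    have h4 : 1 + t + 2 * (1 + t * r) ≤ 2 * ((1 + t * r) ^ 2 * (2 + t)) := by nlinarith
    nlinarith
  refine ⟨?_, ?_, ?_⟩
  · have hq0 : 0 ≤ (2 + t + t * r) / ((1 + t * r) ^ 2 * (2 + t)) := by positivity
    have hq1 : (2 + t + t * r) / ((1 + t * r) ^ 2 * (2 + t)) ≤ 1 := by
      rw [div_le_one (by positivity)]
      nlinarith [mul_nonneg htr ht.le, mul_nonneg htr htr, mul_nonneg (mul_nonneg htr htr) ht.le]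
    simp only [D, mul_pow]
    exact mul_le_of_le_one_right (sq_nonneg _) (pow_le_one₀ hq0 hq1)
  · nlinarith [mul_nonneg (sq_nonneg (r - 1)) hc0]
  · nlinarith [mul_le_mul_of_nonneg_left hc2 (sq_nonneg (r - 1))]

lemma sqrt_one_add_le {d : ℝ} (hd : 0 ≤ 1 + d) : Real.sqrt (1 + d) ≤ 1 + d / 2 := by
  rw [Real.sqrt_le_left (by linarith)]
  nlinarith [sq_nonneg d]

lemma le_sqrt_one_add {d : ℝ} (hd : 0 ≤ 1 + d) :
    1 + d / 2 - d ^ 2 / 2 ≤ Real.sqrt (1 + d) := by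
  have hy := Real.sqrt_nonneg (1 + d)
  have hs := Real.sq_sqrt hd
  generalize Real.sqrt (1 + d) = y at hy hs ⊢
  obtain rfl : d = y ^ 2 - 1 := by linarith
  -- The difference of the two sides is exactly `(y - 1)² * y * (y + 2) / 2`.
  nlinarith [mul_nonneg (sq_nonneg (y - 1)) (mul_nonneg hy (by linarith : 0 ≤ y + 2))]

/-- `√(1 - (1 + x)⁻²)`, the square root of the dispersion in nats. -/
noncomputable def sqrtDispersion (x : ℝ) : ℝ := Real.sqrt (1 - ((1 + x) ^ 2)⁻¹)

/-- The `3 / 2` is `1` from half the quadratic loss in the tangent bound plus `1 / 2` from the term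
`D ^ 2 / 2` of `le_sqrt_one_add`. -/
lemma sqrtDispersion_bounds {t r : ℝ} (ht : 0 < t) (hr : 0 ≤ r) :
    let a := 2 / ((1 + t) * (2 + t))
    sqrtDispersion t * (1 + a / 2 * (r - 1) - 3 / 2 * (r - 1) ^ 2) ≤ sqrtDispersion (t * r) ∧
      sqrtDispersion (t * r) ≤ sqrtDispersion t * (1 + a / 2 * (r - 1)) := by
  intro a
  have hs : 0 < 1 - ((1 + t) ^ 2)⁻¹ := by
    rw [sub_pos]; exact inv_lt_one_of_one_lt₀ (by nlinarith)
  have hs' : 0 ≤ 1 - ((1 + t * r) ^ 2)⁻¹ := by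
    have : 0 ≤ t * r := by positivity
    rw [sub_nonneg]; exact inv_le_one_of_one_le₀ (by nlinarith)
  obtain ⟨h1, h2, h3⟩ := ratio_sub_one_bounds ht hr
  have hrat := one_sub_inv_sq_ratio ht hr
  set D := (r - 1) * ((2 + t + t * r) / ((1 + t * r) ^ 2 * (2 + t)))
  have hD : 0 ≤ 1 + D := by rw [← hrat]; positivity
  have heq : sqrtDispersion (t * r) = sqrtDispersion t * Real.sqrt (1 + D) := by
    rw [sqrtDispersion, sqrtDispersion, ← Real.sqrt_mul hs.le, ← hrat, mul_div_cancel₀ _ hs.ne']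
  have h0 : 0 ≤ sqrtDispersion t := Real.sqrt_nonneg _
  rw [heq]
  constructor
  · exact mul_le_mul_of_nonneg_left (by linarith [le_sqrt_one_add hD]) h0
  · exact mul_le_mul_of_nonneg_left (by linarith [sqrt_one_add_le hD]) h0

lemma measurable_sqrtDispersion : Measurable sqrtDispersion := by
  unfold sqrtDispersion; fun_prop

lemma sqrtDispersion_le_one (x : ℝ) : sqrtDispersion x ≤ 1 := by
  have : 0 ≤ ((1 + x) ^ 2)⁻¹ := by positivity
  exact Real.sqrt_le_one.2 (by linarith)

lemma integrable_sqrtDispersion {N : ℕ} (hN : 1 ≤ N) (γ : ℝ) :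
    Integrable (fun x => sqrtDispersion (γ * x)) (gammaMeasure N 1) := by
  have := isProbabilityMeasure_gammaMeasure (a := N) (r := 1) (by exact_mod_cast hN) one_pos
  refine Integrable.of_bound
    (measurable_sqrtDispersion.comp (measurable_const_mul γ)).aestronglyMeasurable 1
    (ae_of_all _ fun x => ?_)
  rw [Real.norm_of_nonneg (show 0 ≤ sqrtDispersion (γ * x) from Real.sqrt_nonneg _)]
  exact sqrtDispersion_le_one _

/-- The Laplace approximation of the expected root dispersion, relative to its value at the mode
of the Gamma density. -/
lemma exists_integral_sqrtDispersion_eq {m : ℕ} (hm : 1 ≤ m) {γ : ℝ} (hγ : 0 < γ) :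
    ∃ δ : ℝ, |δ| ≤ 9 / 2 / m ∧
      ∫ x, sqrtDispersion (γ * x) ∂(gammaMeasure (m + 1 : ℕ) 1)
        = (1 + δ) * sqrtDispersion (γ * m) := by
  have hm1 : (1 : ℝ) ≤ m := by exact_mod_cast hm
  have hm0 : (0 : ℝ) < m := by linarith
  have := isProbabilityMeasure_gammaMeasure (a := (m + 1 : ℕ)) (r := 1) (by positivity) one_pos
  have ht : 0 < γ * m := by positivity
  set t := γ * m with htdef
  set a := 2 / ((1 + t) * (2 + t)) with hadef
  have ha0 : 0 ≤ a := by positivity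
  have ha1 : a ≤ 1 := by
    rw [hadef, div_le_one (by positivity)]; nlinarith
  have hs0 : 0 < sqrtDispersion t := by
    rw [sqrtDispersion, Real.sqrt_pos, sub_pos]
    exact inv_lt_one_of_one_lt₀ (by nlinarith)
  have hi1 : Integrable (fun x : ℝ => x) (gammaMeasure (m + 1 : ℕ) 1) := by
    simpa using integrable_pow_gammaMeasure m 1
  have hi2 := integrable_pow_gammaMeasure m 2
  have he1 : ∫ x, x ∂(gammaMeasure (m + 1 : ℕ) 1) = m + 1 := by
    have h := integral_pow_gammaMeasure m 1
    simp only [pow_one] at h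
    rw [h, Nat.factorial_succ]
    have : (m.factorial : ℝ) ≠ 0 := by positivity
    push_cast
    field_simp
  have he2 : ∫ x, x ^ 2 ∂(gammaMeasure (m + 1 : ℕ) 1) = (m + 2) * (m + 1) := by
    rw [integral_pow_gammaMeasure m 2, Nat.factorial_succ, Nat.factorial_succ]
    have : (m.factorial : ℝ) ≠ 0 := by positivity
    push_cast
    field_simp
    ring
  have hir : Integrable (fun x : ℝ => x / m - 1) (gammaMeasure (m + 1 : ℕ) 1) :=
    (hi1.div_const _).sub (integrable_const _)
  have her : ∫ x, (x / m - 1) ∂(gammaMeasure (m + 1 : ℕ) 1) = 1 / m := by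
    rw [integral_sub (hi1.div_const _) (integrable_const _), integral_div, he1, integral_const,
      probReal_univ, one_smul]
    field_simp
    ring
  have hrsq : ∀ x : ℝ, (x / m - 1) ^ 2 = x ^ 2 / m ^ 2 - 2 * (x / m - 1) - 1 := by
    intro x; field_simp; ring
  have hir2 : Integrable (fun x : ℝ => (x / m - 1) ^ 2) (gammaMeasure (m + 1 : ℕ) 1) := by
    simp_rw [hrsq]
    exact ((hi2.div_const _).sub (hir.const_mul 2)).sub (integrable_const _)
  have her2 : ∫ x, (x / m - 1) ^ 2 ∂(gammaMeasure (m + 1 : ℕ) 1) = ((m : ℝ) + 2) / (m : ℝ) ^ 2 := by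
    have hA : Integrable (fun x : ℝ => x ^ 2 / m ^ 2 - 2 * (x / m - 1))
      (gammaMeasure (m + 1 : ℕ) 1) := (hi2.div_const _).sub (hir.const_mul 2)
    simp_rw [hrsq]
    rw [integral_sub hA (integrable_const _),
      integral_sub (hi2.div_const _) (hir.const_mul 2), integral_div, integral_const_mul, he2, her,
      integral_const, probReal_univ, one_smul]
    field_simp
    ring
  have hB : Integrable (fun x : ℝ => 1 + a / 2 * (x / m - 1)) (gammaMeasure (m + 1 : ℕ) 1) :=
    (integrable_const _).add (hir.const_mul _)
  have hBe : ∫ x, (1 + a / 2 * (x / m - 1)) ∂(gammaMeasure (m + 1 : ℕ) 1)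
      = 1 + a / 2 * (1 / m) := by
    rw [integral_add (integrable_const _) (hir.const_mul _), integral_const_mul, her,
      integral_const, probReal_univ, one_smul]
  have hpt : ∀ᵐ x ∂(gammaMeasure (m + 1 : ℕ) 1),
      sqrtDispersion t * (1 + a / 2 * (x / m - 1) - 3 / 2 * (x / m - 1) ^ 2)
        ≤ sqrtDispersion (γ * x) ∧
      sqrtDispersion (γ * x) ≤ sqrtDispersion t * (1 + a / 2 * (x / m - 1)) := by
    filter_upwards [ae_nonneg_gammaMeasure _ _] with x hx
    have h := sqrtDispersion_bounds ht (div_nonneg hx hm0.le)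
    rwa [show t * (x / m) = γ * x by rw [htdef]; field_simp] at h
  have hint := integrable_sqrtDispersion (N := m + 1) (by omega) γ
  have hup : ∫ x, sqrtDispersion (γ * x) ∂(gammaMeasure (m + 1 : ℕ) 1)
      ≤ sqrtDispersion t * (1 + a / 2 * (1 / m)) := by
    rw [← hBe, ← integral_const_mul]
    exact integral_mono_ae hint (hB.const_mul _) (hpt.mono fun x hx => hx.2)
  have hlo : sqrtDispersion t * (1 + a / 2 * (1 / m) - 3 / 2 * (((m : ℝ) + 2) / (m : ℝ) ^ 2))
      ≤ ∫ x, sqrtDispersion (γ * x) ∂(gammaMeasure (m + 1 : ℕ) 1) := by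
    rw [← hBe, ← her2, ← integral_const_mul (3 / 2 : ℝ),
      ← integral_sub hB (hir2.const_mul _), ← integral_const_mul]
    exact integral_mono_ae ((hB.sub (hir2.const_mul _)).const_mul _) hint (hpt.mono fun x hx => hx.1)
  refine ⟨(∫ x, sqrtDispersion (γ * x) ∂(gammaMeasure (m + 1 : ℕ) 1)) / sqrtDispersion t - 1, ?_, ?_⟩
  · have h1 : a / 2 * (1 / m) ≤ 9 / 2 / m := by
      rw [mul_one_div]; gcongr; linarith
    -- Since `m + 2 ≤ 3 * m`; this lower bound determines the constant `9 / 2`.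
    have h2 : 3 / 2 * (((m : ℝ) + 2) / m ^ 2) ≤ 9 / 2 / m := by
      rw [← mul_div_assoc, div_le_div_iff₀ (by positivity) hm0]
      nlinarith
    have h3 : 0 ≤ a / 2 * (1 / (m : ℝ)) := by positivity
    rw [abs_le]
    constructor
    · rw [le_sub_iff_add_le, le_div_iff₀ hs0]
      refine le_trans ?_ hlo
      rw [mul_comm]
      exact mul_le_mul_of_nonneg_left (by linarith) hs0.le
    · rw [sub_le_iff_le_add, div_le_iff₀ hs0]
      refine hup.trans ?_
      rw [mul_comm]
      exact mul_le_mul_of_nonneg_right (by linarith) hs0.le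
  · field_simp
    ring

/-! ### Stirling's formula with a relative error bound -/

/-- The decrements of `log (stirlingSeq n)` are at most `1 / (12 n (n + 1))`, which telescopes.
Subtracting `1 / (12 n)` thus gives an increasing sequence, bounded by its limit `log √π`. -/
lemma log_stirlingSeq_le {n : ℕ} (hn : 1 ≤ n) :
    Real.log (Stirling.stirlingSeq n) ≤ Real.log (Real.sqrt Real.pi) + 1 / (12 * n) := by
  obtain ⟨k, rfl⟩ : ∃ k, n = k + 1 := ⟨n - 1, by omega⟩
  let f : ℕ → ℝ := fun k => Real.log (Stirling.stirlingSeq (k + 1)) - 1 / (12 * (k + 1 : ℕ))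
  have hmono : Monotone f := by
    refine monotone_nat_of_le_succ fun j => ?_
    have h := Stirling.log_stirlingSeq_sdiff_le (j + 1)
    have h2 : (1 : ℝ) / (12 * (j + 1 : ℕ) * ((j + 1 : ℕ) + 1))
        = 1 / (12 * (j + 1 : ℕ)) - 1 / (12 * (j + 1 + 1 : ℕ)) := by
      push_cast
      field_simp
      ring
    simp only [f]
    linarith
  have hlim : Filter.Tendsto f Filter.atTop (nhds (Real.log (Real.sqrt Real.pi) - 0)) := by
    refine Filter.Tendsto.sub ?_ ?_
    · exact ((Filter.tendsto_add_atTop_iff_nat 1).2 Stirling.tendsto_stirlingSeq_sqrt_pi).log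
        (by positivity)
    · refine ((tendsto_one_div_add_atTop_nhds_zero_nat (𝕜 := ℝ)).const_mul (1 / 12)).congr'
        (Filter.Eventually.of_forall fun j => ?_) |>.trans (by simp)
      push_cast
      field_simp
  have := hmono.ge_of_tendsto hlim k
  simp only [f, sub_zero] at this
  linarith

lemma exists_factorial_eq_stirling {n : ℕ} (hn : 1 ≤ n) :
    ∃ ρ : ℝ, 0 ≤ ρ ∧ ρ ≤ 1 / (6 * n) ∧
      (n.factorial : ℝ) = (1 + ρ) * (Real.sqrt (2 * n) * (n / Real.exp 1) ^ n * Real.sqrt Real.pi) := by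
  have hn0 : (0 : ℝ) < n := by exact_mod_cast hn
  have hpi : 0 < Real.sqrt Real.pi := by positivity
  have hlow := Stirling.sqrt_pi_le_stirlingSeq (n := n) (by omega)
  have hpos : 0 < Stirling.stirlingSeq n := hpi.trans_le hlow
  have hden : 0 < Real.sqrt (2 * n) * (n / Real.exp 1) ^ n := by positivity
  refine ⟨Stirling.stirlingSeq n / Real.sqrt Real.pi - 1, ?_, ?_, ?_⟩
  · rw [sub_nonneg, one_le_div hpi]; exact hlow
  · have hx : (1 : ℝ) / (12 * n) ≤ 1 := by
      rw [div_le_one (by positivity)]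
      have : (1 : ℝ) ≤ n := by exact_mod_cast hn
      linarith
    have hx0 : (0 : ℝ) ≤ 1 / (12 * n) := by positivity
    have h1 : Stirling.stirlingSeq n / Real.sqrt Real.pi ≤ Real.exp (1 / (12 * n)) := by
      rw [← Real.log_le_iff_le_exp (by positivity), Real.log_div hpos.ne' hpi.ne']
      linarith [log_stirlingSeq_le hn]
    -- The bound `e^x - 1 ≤ 2 x` at `x = 1 / (12 n)` yields the `1 / (6 n)`.
    have h2 := Real.abs_exp_sub_one_le (x := 1 / (12 * n)) (by rwa [abs_of_nonneg hx0])
    rw [abs_of_nonneg hx0] at h2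
    have h3 : 2 * (1 / (12 * (n : ℝ))) = 1 / (6 * n) := by field_simp; norm_num
    linarith [le_abs_self (Real.exp (1 / (12 * (n : ℝ))) - 1)]
  · rw [Stirling.stirlingSeq]
    field_simp
    ring

/-! ### The dispersion term against `Psi`. -/

lemma sqrt_dispersion_eq (T : ℕ) (x : ℝ) :
    Real.sqrt (1 / (T : ℝ) * dispersion x)
      = Real.sqrt (1 / (T : ℝ)) * (1 / Real.log 2) * sqrtDispersion x := by
  have hlog : 0 < Real.log 2 := Real.log_pos one_lt_two
  rw [dispersion, Real.sqrt_mul (by positivity), Real.sqrt_mul (by positivity), Real.logb,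
    Real.log_exp, Real.sqrt_sq (by positivity), sqrtDispersion, mul_assoc]

/-- Compared with the value at the mode, `Psi` carries the extra factor `√(2π) m^{m+1/2} e^{-m} /
m!`, which is `1 / (1 + ρ)` by Stirling. -/
lemma exists_laplace_value_eq_Psi {m : ℕ} (hm : 1 ≤ m) (ε γ : ℝ) (T : ℕ) :
    ∃ ρ : ℝ, 0 ≤ ρ ∧ ρ ≤ 1 / (6 * m) ∧
      Real.sqrt (1 / (T : ℝ)) * (1 / Real.log 2) * sqrtDispersion (γ * m) * gaussQInv ε
        = (1 + ρ) * Psi ε γ (m + 1) T := by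
  obtain ⟨ρ, h0, h1, hρ⟩ := exists_factorial_eq_stirling hm
  refine ⟨ρ, h0, h1, ?_⟩
  have hm0 : (0 : ℝ) < m := by exact_mod_cast hm
  have hlog : 0 < Real.log 2 := Real.log_pos one_lt_two
  have hpow : (m : ℝ) ^ ((m : ℝ) + 1 / 2) = (m : ℝ) ^ m * Real.sqrt m := by
    rw [Real.rpow_add hm0, Real.rpow_natCast, Real.sqrt_eq_rpow]
  have hexp : Real.exp (-(m : ℝ)) = (Real.exp 1 ^ m)⁻¹ := by
    rw [Real.exp_neg, ← Real.exp_nat_mul, mul_one]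
  have hsq : Real.sqrt (2 * Real.pi / T)
      = Real.sqrt 2 * Real.sqrt Real.pi * Real.sqrt (1 / (T : ℝ)) := by
    rw [← mul_one_div, Real.sqrt_mul (by positivity), Real.sqrt_mul (by positivity)]
  have hexpo : (m : ℝ) + 1 - 1 / 2 = m + 1 / 2 := by ring
  rw [Psi, Nat.cast_add, Nat.cast_one, Real.Gamma_nat_eq_factorial, add_sub_cancel_right, hexpo,
    hpow, hexp, hsq, hρ, Real.sqrt_mul (by positivity : (0 : ℝ) ≤ 2), sqrtDispersion, div_pow]
  have h2 : 0 < Real.sqrt 2 := by positivity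
  have h3 : 0 < Real.sqrt Real.pi := by positivity
  have h4 : 0 < Real.sqrt (m : ℝ) := by positivity
  have h5 : 0 < 1 + ρ := by linarith
  generalize Real.sqrt 2 = a at *
  generalize Real.sqrt Real.pi = b at *
  generalize Real.sqrt (m : ℝ) = c at *
  field_simp

lemma exists_integral_dispersion_eq_Psi {N : ℕ} (hN : 2 ≤ N) (ε : ℝ) {γ : ℝ} (hγ : 0 < γ) (T : ℕ) :
    ∃ δ : ℝ, |δ| ≤ 11 / N ∧
      ∫ x, Real.sqrt (1 / (T : ℝ) * dispersion (γ * x)) * gaussQInv ε ∂(gammaMeasure N 1)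
        = (1 + δ) * Psi ε γ N T := by
  obtain ⟨m, rfl⟩ : ∃ m, N = m + 1 := ⟨N - 1, by omega⟩
  have hm : 1 ≤ m := by omega
  have hm1 : (1 : ℝ) ≤ m := by exact_mod_cast hm
  obtain ⟨δ, hδ, hint⟩ := exists_integral_sqrtDispersion_eq hm hγ
  obtain ⟨ρ, hρ0, hρ1, hΨ⟩ := exists_laplace_value_eq_Psi hm ε γ T
  refine ⟨(1 + δ) * (1 + ρ) - 1, ?_, ?_⟩
  · have h1 : 9 / 2 / (m : ℝ) ≤ 9 / (m + 1 : ℕ) := by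
      rw [div_div, div_le_div_iff₀ (by positivity) (by positivity)]
      push_cast
      linarith
    have h2 : 1 / (6 * (m : ℝ)) ≤ 1 / 3 / (m + 1 : ℕ) := by
      rw [div_div, div_le_div_iff₀ (by positivity) (by positivity)]
      push_cast
      linarith
    have h3 : 1 / (6 * (m : ℝ)) ≤ 1 / 6 := by
      apply one_div_le_one_div_of_le <;> linarith
    have hδN := hδ.trans h1
    have hρN := hρ1.trans h2
    have hN0 : (0 : ℝ) < (m + 1 : ℕ) := by positivity
    have h9 : 9 / ((m + 1 : ℕ) : ℝ) = 9 * (1 / (m + 1 : ℕ)) := by ring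
    have h11 : 11 / ((m + 1 : ℕ) : ℝ) = 11 * (1 / (m + 1 : ℕ)) := by ring
    have h13 : 1 / 3 / ((m + 1 : ℕ) : ℝ) = 1 / 3 * (1 / (m + 1 : ℕ)) := by ring
    have hpos : 0 < 1 / ((m + 1 : ℕ) : ℝ) := by positivity
    calc |(1 + δ) * (1 + ρ) - 1| = |δ * (1 + ρ) + ρ| := by ring_nf
      _ ≤ |δ| * (1 + ρ) + ρ := by
        refine (abs_add_le _ _).trans (le_of_eq ?_)
        rw [abs_mul, abs_of_nonneg hρ0, abs_of_nonneg (by linarith : 0 ≤ 1 + ρ)]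
      -- Passing from `m` to `N = m + 1 ≤ 2 * m` doubles the constants; then `9 * 7 / 6 + 1 / 3 <
      -- 11`.
      _ ≤ 9 / (m + 1 : ℕ) * (1 + 1 / 6) + 1 / 3 / (m + 1 : ℕ) := by
        gcongr
        exact hρ1.trans h3
      _ ≤ 11 / (m + 1 : ℕ) := by
        rw [h9, h11, h13]; linarith
  · simp_rw [sqrt_dispersion_eq]
    rw [integral_mul_const, integral_const_mul, hint]
    linear_combination (1 + δ) * hΨ

/-- `log (1 + x) ≤ x` reduces this to the first Gamma moment. -/
lemma integrable_capacity_gammaMeasure {N : ℕ} (hN : 1 ≤ N) {γ : ℝ} (hγ : 0 ≤ γ) :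
    Integrable (fun x => capacity (γ * x)) (gammaMeasure N 1) := by
  obtain ⟨m, rfl⟩ : ∃ m, N = m + 1 := ⟨N - 1, by omega⟩
  have hlog : 0 < Real.log 2 := Real.log_pos one_lt_two
  have h1 : Integrable (fun x : ℝ => x) (gammaMeasure (m + 1 : ℕ) 1) := by
    simpa using integrable_pow_gammaMeasure m 1
  have hmeas : Measurable fun x => capacity (γ * x) := by
    unfold capacity Real.logb; fun_prop
  refine Integrable.mono' (h1.const_mul (γ / Real.log 2)) hmeas.aestronglyMeasurable ?_
  filter_upwards [ae_nonneg_gammaMeasure _ _] with x hx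
  have hγx : 0 ≤ γ * x := mul_nonneg hγ hx
  have hl0 : 0 ≤ Real.log (1 + γ * x) := Real.log_nonneg (by linarith)
  rw [capacity, Real.logb, Real.norm_of_nonneg (div_nonneg hl0 hlog.le), div_mul_eq_mul_div]
  gcongr
  linarith [Real.log_le_sub_one_of_pos (by linarith : 0 < 1 + γ * x)]

lemma measurable_capacity : Measurable capacity := by
  unfold capacity Real.logb; fun_prop

lemma measurable_dispersion : Measurable dispersion := by
  unfold dispersion; fun_prop

end ChannelTraining

open ChannelTraining
-- Transfer from the Gamma law to the model.
theorem theorem2 :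
    ∃ K : ℝ, 0 < K ∧
      ∀ (N Ttr T : ℕ) (P : ℝ) (σsq : ℝ≥0) (ε : ℝ),
        1 ≤ N → N ≤ Ttr → Ttr ≤ T → 0 < P → 0 < σsq → 0 < ε → ε < 1 →
      ∀ (Ω : Type*) [MeasurableSpace Ω] (μ : Measure Ω) [IsProbabilityMeasure μ]
        (S : Matrix (Fin N) (Fin Ttr) ℂ) (h : Ω → Fin N → ℂ) (nd : Ω → Fin Ttr → ℂ)
        (u n : Ω → ℂ), IsDownlinkModel μ σsq S h nd u n →
      -- `σ²_ĥ` and `σ²_ê` are the variances of the entries of the estimate and of the error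
      (∀ j, complexVariance (fun ω => estimate P σsq S (h ω) (nd ω) j) μ
          = estimateVar N Ttr P σsq) ∧
      (∀ j, complexVariance (fun ω => estimationError P σsq S (h ω) (nd ω) j) μ
          = errorVar N Ttr P σsq) ∧
      -- the expectations exist
      Integrable (fun ω => capacity (sinr μ P σsq S h nd u n ω)) μ ∧
      Integrable (fun ω =>
        Real.sqrt (1 / (T : ℝ) * dispersion (sinr μ P σsq S h nd u n ω)) * gaussQInv ε) μ ∧
      -- the capacity term is exactly `Φ`
      ((∫ ω, capacity (sinr μ P σsq S h nd u n ω) ∂μ : ℝ) : ℂ)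
          = Phi (effectiveSNR N Ttr P σsq) N ∧
      -- the dispersion term is `Ψ` up to a relative error `O(1 / N)`, uniformly in all parameters
      (2 ≤ N → ∃ δ : ℝ, |δ| ≤ K / N ∧
        ∫ ω, Real.sqrt (1 / (T : ℝ) * dispersion (sinr μ P σsq S h nd u n ω)) * gaussQInv ε ∂μ
          = (1 + δ) * Psi ε (effectiveSNR N Ttr P σsq) N T ∧
        ((downlinkRate μ T ε P σsq S h nd u n : ℝ) : ℂ)
          = (1 - (Ttr : ℂ) / T) *
              (Phi (effectiveSNR N Ttr P σsq) N
                - (1 + δ) * Psi ε (effectiveSNR N Ttr P σsq) N T)) := by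
  refine ⟨11, by norm_num, ?_⟩
  intro N Ttr T P σsq ε hN hNT _ hP hσ _ _ Ω _ μ _ S h nd u n hm
  have hΛ := pilotPower_pos hN hNT hP
  have hγ := effectiveSNR_pos (N := N) (Ttr := Ttr) (σsq := σsq) hP hσ hΛ
  obtain ⟨X, hX, hsinr⟩ := hm.exists_sinr_eq hN hP hσ hΛ
  obtain ⟨κ, hκ⟩ : ∃ κ : ℝ≥0, (κ : ℝ) = estimateVar N Ttr P σsq :=
    ⟨⟨_, estimateVar_nonneg hΛ.le⟩, rfl⟩
  obtain ⟨η, hη⟩ : ∃ η : ℝ≥0, (η : ℝ) = errorVar N Ttr P σsq :=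
    ⟨⟨_, errorVar_nonneg hΛ.le⟩, rfl⟩
  have hpair := hm.hasLaw_estimate_error hΛ hκ hη
  have hest : ∀ j, HasLaw (fun ω => estimate P σsq S (h ω) (nd ω) j) (complexGaussian κ) μ :=
    fun j => (hasLaw_eval j).fun_comp (measurePreserving_fst.fun_comp_hasLaw hpair)
  have herr : ∀ j, HasLaw (fun ω => estimationError P σsq S (h ω) (nd ω) j)
      (complexGaussian η) μ :=
    fun j => (hasLaw_eval j).fun_comp (measurePreserving_snd.fun_comp_hasLaw hpair)
  -- From here on both expectations depend on the model only through `X` and the positive number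
  -- `γ`.
  simp only [downlinkRate, hsinr]
  generalize effectiveSNR N Ttr P σsq = γ at hγ ⊢
  have hcapm : Measurable fun x => capacity (γ * x) :=
    measurable_capacity.comp (measurable_const_mul γ)
  have hdispm : Measurable fun x =>
      Real.sqrt (1 / (T : ℝ) * dispersion (γ * x)) * gaussQInv ε :=
    (((measurable_dispersion.comp (measurable_const_mul γ)).const_mul _).sqrt).mul_const _
  have hcapi : Integrable (fun ω => capacity (γ * X ω)) μ := by
    have := integrable_capacity_gammaMeasure hN hγ.le
    rw [← hX.map_eq] at this
    exact this.comp_aemeasurable hX.aemeasurable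
  have hdispi : Integrable (fun ω =>
      Real.sqrt (1 / (T : ℝ) * dispersion (γ * X ω)) * gaussQInv ε) μ := by
    have : Integrable (fun x => Real.sqrt (1 / (T : ℝ) * dispersion (γ * x)) * gaussQInv ε)
        (gammaMeasure N 1) := by
      simp_rw [sqrt_dispersion_eq]
      exact ((integrable_sqrtDispersion hN γ).const_mul _).mul_const _
    rw [← hX.map_eq] at this
    exact this.comp_aemeasurable hX.aemeasurable
  have hcap : ((∫ ω, capacity (γ * X ω) ∂μ : ℝ) : ℂ) = Phi γ N := by
    rw [← integral_capacity_gammaMeasure hN hγ]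
    exact congrArg _ (hX.integral_comp hcapm.aestronglyMeasurable)
  refine ⟨fun j => (complexVariance_of_hasLaw (hest j)).trans hκ,
    fun j => (complexVariance_of_hasLaw (herr j)).trans hη, hcapi, hdispi, hcap, fun hN2 => ?_⟩
  obtain ⟨δ, hδ, hΨ⟩ := exists_integral_dispersion_eq_Psi hN2 ε hγ T
  have hdisp : ∫ ω, Real.sqrt (1 / (T : ℝ) * dispersion (γ * X ω)) * gaussQInv ε ∂μ
      = (1 + δ) * Psi ε γ N T :=
    (hX.integral_comp hdispm.aestronglyMeasurable).trans hΨ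
  refine ⟨δ, hδ, hdisp, ?_⟩
  rw [integral_sub hcapi hdispi, hdisp]
  push_cast
  rw [hcap]
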